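/- Let $n\ge 2$ and $\alpha\in(0,1)$. For $\varphi\in C^\infty_c(\mathbb R^n;\mathbb R^n)$ let $$\operatorname{div}^\alpha\varphi(x)=\mu_{n,\alpha}\lim_{\varepsilon\to0^+}\int_{\{|y|>\varepsilon\}}\frac{y\cdot\varphi(x+y)}{|y|^{n+\alpha+1}}\,dy,\qquad \mu_{n,\alpha}=2^\alpha\pi^{-n/2}\,\frac{\Gamma\left(\frac{n+\alpha+1}2\right)}{\Gamma\left(\frac{1-\alpha}2\right)},$$ and for $f\in L^1(\mathbb R^n)$ let $$|D^\alpha f|(\mathbb R^n)=\sup\Big\{\int_{\mathbb R^n} f\,\operatorname{div}^\alpha\varphi\,dx:\ \varphi\in C_c^\infty(\mathbb R^n;\mathbb R^n),\ \|\varphi\|_{L^\infty}\le1\Big\}.$$ Let $BV^\alpha(\mathbb R^n)$ be the space of $f\in L^1(\mathbb R^n)$ with $|D^\alpha f|(\mathbb R^n)<\infty$, with norm $\|f\|_{L^1}+|D^\alpha f|(\mathbb R^n)$, and let $B^\alpha_{1,\infty}(\mathbb R^n)$ be the Besov space of $f\in L^1(\mathbb R^n)$ with $[f]:=\sup_{h\ne0}|h|^{-\alpha}\|f(\cdot+h)-f\|_{L^1}<\infty$,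 with norm $\|f\|_{L^1}+[f]$. Then $BV^\alpha(\mathbb R^n)\subset B^\alpha_{1,\infty}(\mathbb R^n)$, the inclusion is continuous (there is a constant $C$, depending only on $n$ and $\alpha$, with $\|f\|_{B^\alpha_{1,\infty}}\le C\|f\|_{BV^\alpha}$ for all $f\in BV^\alpha(\mathbb R^n)$), and it is strict. Moreover, let $\eta\in C^\infty_c(\mathbb R)$ be any function with $0\le\eta\le1$, $\eta=1$ on $[-\frac12,\frac12]$, $\operatorname{supp}\eta\subset[-1,1]$ and $\operatorname{Lip}(\eta)\le3$, and put $\eta_1(x)=\eta(|x|)$ for $x\in\mathbb R^n$. Then the function $f(x)=\eta_1(x)\,|x|^{\alpha-n}$ belongs to $B^\alpha_{1,\infty}(\mathbb R^n)$, but not to $L^{n/(n-\alpha)}(\mathbb R^n)$, and not to $BV^\alpha(\mathbb R^n)$. -/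

import Mathlib

/-!
Let `K(z) = z / |z|^{n+1-α}` be the Riesz kernel. Writing the powers of `|z|` in `K` and in
`div^α` as Mellin transforms of the heat kernel shows that convolution with `K` inverts `div^α` up
to a constant: `div^α (K * u) = c u`. For a test function `g` with `|g| ≤ 1` this gives
`∫ (f(· + h) - f) g = ∫ f (g(· - h) - g) = c⁻¹ ∫ f div^α (K * (g(· - h) - g))`, and the field
`K * (g(· - h) - g) = (K(· - h) - K) * g` is bounded by `‖K(· - h) - K‖_{L¹} = O(|h|^α)`. Hence the
`L¹` modulus of continuity of `f` is at most a constant times `|h|^α |D^α f|`.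

The function `f = η_1 |x|^{α-n}` has the same singularity as `K`, so the same estimate puts it in
the Besov space. Its fractional gradient behaves like `-c x / |x|^{n+1}` near the origin, which is
not integrable. Rigorously, `(|x - y|^{α-n} - |x + y|^{α-n}) (x · y) ≥ 0`, so nothing cancels in the
principal value, and the contribution of `|y - x| < |x| / 2` alone is of order `|x|^{-n}`; testing
`f` against radial fields carried by shells `δ < |x| < r` with `δ → 0` gives `|D^α f| = ∞`.
-/

open MeasureTheory Filter Topology
open scoped NNReal ENNReal ContDiff

noncomputable section

namespace FracBV

/-- The constant `μ_{n,α} = 2^α π^{-n/2} Γ((n+α+1)/2) / Γ((1-α)/2)`. -/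
def muConst (n : ℕ) (α : ℝ) : ℝ :=
  (2 : ℝ) ^ α * Real.pi ^ (-((n : ℝ) / 2)) *
    (Real.Gamma (((n : ℝ) + α + 1) / 2) / Real.Gamma ((1 - α) / 2))

/-- The fractional `α`-divergence of a vector field, as a principal value at the origin.
For smooth compactly supported `φ` and `α ∈ (0,1)` the integrals converge and the limit exists. -/
def fracDiv {n : ℕ} (α : ℝ) (φ : EuclideanSpace ℝ (Fin n) → EuclideanSpace ℝ (Fin n))
    (x : EuclideanSpace ℝ (Fin n)) : ℝ :=
  muConst n α *
    limUnder (𝓝[>] (0 : ℝ)) (fun ε : ℝ =>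
      ∫ y in {y : EuclideanSpace ℝ (Fin n) | ε < ‖y‖},
        inner ℝ y (φ (x + y)) / ‖y‖ ^ ((n : ℝ) + α + 1))

/-- Vector fields in `C_c^∞(ℝⁿ; ℝⁿ)` with sup norm at most `1`. -/
structure IsTestField {n : ℕ} (φ : EuclideanSpace ℝ (Fin n) → EuclideanSpace ℝ (Fin n)) :
    Prop where
  smooth : ContDiff ℝ (∞ : WithTop ℕ∞) φ
  compactSupport : HasCompactSupport φ
  norm_le_one : ∀ x, ‖φ x‖ ≤ 1

/-- The fractional variation `|D^α f|(ℝⁿ)`, the supremum of `∫ f div^α φ` over test fields.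
Since `φ = 0` is allowed, the supremum is nonnegative and truncating at `0` is harmless. -/
def fracVariation {n : ℕ} (α : ℝ) (f : EuclideanSpace ℝ (Fin n) → ℝ) : ℝ≥0∞ :=
  ⨆ (φ : EuclideanSpace ℝ (Fin n) → EuclideanSpace ℝ (Fin n)) (_ : IsTestField φ),
    ENNReal.ofReal (∫ x, f x * fracDiv α φ x)

/-- `BV^α(ℝⁿ)`: the integrable functions of finite fractional `α`-variation. -/
def BVSpace (n : ℕ) (α : ℝ) : Set (EuclideanSpace ℝ (Fin n) → ℝ) :=
  {f | MemLp f 1 volume ∧ fracVariation α f < ⊤}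

/-- The norm of `BV^α(ℝⁿ)`. -/
def bvNorm {n : ℕ} (α : ℝ) (f : EuclideanSpace ℝ (Fin n) → ℝ) : ℝ≥0∞ :=
  eLpNorm f 1 volume + fracVariation α f

/-- The Besov seminorm `sup_{h ≠ 0} ‖f(· + h) - f‖_{L¹} / |h|^α`. -/
def besovSeminorm {n : ℕ} (α : ℝ) (f : EuclideanSpace ℝ (Fin n) → ℝ) : ℝ≥0∞ :=
  ⨆ (h : EuclideanSpace ℝ (Fin n)) (_ : h ≠ 0),
    eLpNorm (fun x => f (x + h) - f x) 1 volume / ENNReal.ofReal (‖h‖ ^ α)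

/-- The Besov space `B^α_{1,∞}(ℝⁿ)`, for `α ∈ (0,1)`. -/
def BesovSpace (n : ℕ) (α : ℝ) : Set (EuclideanSpace ℝ (Fin n) → ℝ) :=
  {f | MemLp f 1 volume ∧ besovSeminorm α f < ⊤}

/-- The norm of `B^α_{1,∞}(ℝⁿ)`. -/
def besovNorm {n : ℕ} (α : ℝ) (f : EuclideanSpace ℝ (Fin n) → ℝ) : ℝ≥0∞ :=
  eLpNorm f 1 volume + besovSeminorm α f

/-- Admissible profiles `η ∈ C_c^∞(ℝ)` of the cut-off functions. -/
structure IsCutoffProfile (η : ℝ → ℝ) : Prop where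
  smooth : ContDiff ℝ (∞ : WithTop ℕ∞) η
  nonneg : ∀ t, 0 ≤ η t
  le_one : ∀ t, η t ≤ 1
  eq_one : ∀ t ∈ Set.Icc (-(1 / 2) : ℝ) (1 / 2), η t = 1
  tsupport_subset : tsupport η ⊆ Set.Icc (-1 : ℝ) 1
  lipschitz : LipschitzWith 3 η

/-- The cut-off functions `η_R(x) = η(|x| / R)`. -/
def cutoff {n : ℕ} (η : ℝ → ℝ) (R : ℝ) (x : EuclideanSpace ℝ (Fin n)) : ℝ :=
  η (‖x‖ / R)

/-- The function `η_1(x) |x|^{α - n}`. -/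
def witness (n : ℕ) (α : ℝ) (η : ℝ → ℝ) (x : EuclideanSpace ℝ (Fin n)) : ℝ :=
  cutoff η 1 x * ‖x‖ ^ (α - (n : ℝ))

end FracBV

end

open Module (finrank)

noncomputable section

namespace FracBV

/-! ### Powers of the norm in polar coordinates -/

section Radial

variable {E : Type*} [NormedAddCommGroup E] {r : ℝ}

theorem ball_zero_eq_norm_preimage_Iio : Metric.ball (0 : E) r = (‖·‖) ⁻¹' Set.Iio r := by
  ext; simp

theorem compl_ball_zero_eq_norm_preimage_Ici : (Metric.ball (0 : E) r)ᶜ = (‖·‖) ⁻¹' Set.Ici r := by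
  ext; simp

variable [NormedSpace ℝ E] [FiniteDimensional ℝ E] [Nontrivial E]

theorem pow_finrank_pred_mul_rpow {t : ℝ} (ht : 0 < t) (s : ℝ) :
    t ^ (finrank ℝ E - 1) * t ^ s = t ^ (finrank ℝ E + s - 1) := by
  have hd : 1 ≤ finrank ℝ E := Module.finrank_pos
  rw [← Real.rpow_natCast, ← Real.rpow_add ht, Nat.cast_sub hd]
  congr 1; push_cast; ring

theorem eqOn_pow_finrank_pred_smul_indicator_rpow (S : Set ℝ) (s : ℝ) :
    Set.EqOn (fun t : ℝ => t ^ (finrank ℝ E - 1) • S.indicator (fun t => t ^ s) t)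
      (S.indicator fun t => t ^ (finrank ℝ E + s - 1)) (Set.Ioi 0) := by
  intro t ht
  by_cases hS : t ∈ S
  · simp only [Set.indicator_of_mem hS, smul_eq_mul, pow_finrank_pred_mul_rpow ht]
  · simp only [Set.indicator_of_notMem hS, smul_zero]

variable [MeasurableSpace E] [BorelSpace E] (μ : Measure E) [μ.IsAddHaarMeasure]

theorem integrableOn_norm_preimage_rpow_iff {S : Set ℝ} (hS : MeasurableSet S) (s : ℝ) :
    IntegrableOn (fun x : E => ‖x‖ ^ s) ((‖·‖) ⁻¹' S) μ ↔
      IntegrableOn (fun t : ℝ => t ^ (finrank ℝ E + s - 1)) (S ∩ Set.Ioi 0) := by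
  rw [← integrable_indicator_iff (measurable_norm hS), ← integrableOn_indicator_iff hS,
    ← integrableOn_congr_fun (eqOn_pow_finrank_pred_smul_indicator_rpow (E := E) S s)
      measurableSet_Ioi]
  exact integrable_fun_norm_addHaar μ (f := S.indicator fun t => t ^ s)

theorem setIntegral_norm_preimage_rpow {S : Set ℝ} (hS : MeasurableSet S) (s : ℝ) :
    ∫ x : E in (‖·‖) ⁻¹' S, ‖x‖ ^ s ∂μ =
      μ.toSphere.real Set.univ * ∫ t in Set.Ioi 0 ∩ S, t ^ (finrank ℝ E + s - 1) := by
  rw [← integral_indicator (measurable_norm hS), ← setIntegral_indicator hS,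
    ← setIntegral_congr_fun measurableSet_Ioi
      (eqOn_pow_finrank_pred_smul_indicator_rpow (E := E) S s),
    μ.toSphere_real_apply_univ, mul_assoc, ← nsmul_eq_mul, ← smul_eq_mul (μ.real _)]
  exact integral_fun_norm_addHaar μ (S.indicator fun t => t ^ s)

theorem integrableOn_ball_norm_rpow_iff (hr : 0 < r) {s : ℝ} :
    IntegrableOn (fun x : E => ‖x‖ ^ s) (Metric.ball 0 r) μ ↔ 0 < finrank ℝ E + s := by
  rw [ball_zero_eq_norm_preimage_Iio, integrableOn_norm_preimage_rpow_iff μ measurableSet_Iio,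
    Set.Iio_inter_Ioi, intervalIntegral.integrableOn_Ioo_rpow_iff hr]
  constructor <;> intro h <;> linarith

theorem setIntegral_ball_norm_rpow {β : ℝ} (hβ : 0 < β) (hr : 0 ≤ r) :
    ∫ x : E in Metric.ball 0 r, ‖x‖ ^ (β - finrank ℝ E) ∂μ =
      μ.toSphere.real Set.univ * (r ^ β / β) := by
  rw [ball_zero_eq_norm_preimage_Iio, setIntegral_norm_preimage_rpow μ measurableSet_Iio,
    Set.Ioi_inter_Iio, ← integral_Ioc_eq_integral_Ioo, ← intervalIntegral.integral_of_le hr,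
    add_sub_cancel, integral_rpow (Or.inl (by linarith)), sub_add_cancel, Real.zero_rpow hβ.ne',
    sub_zero]

theorem integrableOn_compl_ball_norm_rpow {β : ℝ} (hβ : 0 < β) (hr : 0 < r) :
    IntegrableOn (fun x : E => ‖x‖ ^ (-β - finrank ℝ E)) (Metric.ball 0 r)ᶜ μ := by
  rw [compl_ball_zero_eq_norm_preimage_Ici,
    integrableOn_norm_preimage_rpow_iff μ measurableSet_Ici,
    Set.inter_eq_left.2 (Set.Ici_subset_Ioi.2 hr), integrableOn_Ici_iff_integrableOn_Ioi,
    add_sub_cancel]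
  exact integrableOn_Ioi_rpow_of_lt (by linarith) hr

theorem setIntegral_compl_ball_norm_rpow {β : ℝ} (hβ : 0 < β) (hr : 0 < r) :
    ∫ x : E in (Metric.ball 0 r)ᶜ, ‖x‖ ^ (-β - finrank ℝ E) ∂μ =
      μ.toSphere.real Set.univ * (r ^ (-β) / β) := by
  rw [compl_ball_zero_eq_norm_preimage_Ici, setIntegral_norm_preimage_rpow μ measurableSet_Ici,
    Set.inter_eq_right.2 (Set.Ici_subset_Ioi.2 hr), integral_Ici_eq_integral_Ioi, add_sub_cancel,
    integral_Ioi_rpow_of_lt (by linarith) hr, sub_add_cancel, neg_div_neg_eq]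

end Radial

/-! ### Kernels with a power singularity -/

section PowerSingularity

theorem abs_rpow_neg_sub_rpow_neg_le {m q r s : ℝ} (hm : 0 < m) (hq : 0 ≤ q) (hr : m ≤ r)
    (hs : m ≤ s) : |r ^ (-q) - s ^ (-q)| ≤ q * m ^ (-q - 1) * |r - s| := by
  refine (convex_Ici m).norm_image_sub_le_of_norm_deriv_le (f := fun t : ℝ => t ^ (-q))
    (fun t ht => ?_) (fun t ht => ?_) hs hr
  · exact (Real.hasDerivAt_rpow_const (Or.inl (hm.trans_le ht).ne')).differentiableAt
  · have ht0 : 0 < t := hm.trans_le ht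
    rw [(Real.hasDerivAt_rpow_const (Or.inl ht0.ne')).deriv, norm_mul, Real.norm_eq_abs, abs_neg,
      abs_of_nonneg hq, Real.norm_of_nonneg (by positivity)]
    have := Real.rpow_le_rpow_of_nonpos (z := -q - 1) hm ht (by linarith)
    gcongr

variable {E : Type*} [NormedAddCommGroup E] {q : ℝ} {x h : E}

theorem norm_div_two_le_norm_add (hxh : 2 * ‖h‖ ≤ ‖x‖) : ‖x‖ / 2 ≤ ‖x + h‖ := by
  have := norm_sub_norm_le x (-h)
  rw [sub_neg_eq_add, norm_neg] at this
  linarith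

theorem norm_div_two_rpow_neg (x : E) (q : ℝ) : (‖x‖ / 2) ^ (-q) = 2 ^ q * ‖x‖ ^ (-q) := by
  rw [Real.div_rpow (norm_nonneg x) zero_le_two, Real.rpow_neg zero_le_two, div_inv_eq_mul,
    mul_comm]

theorem norm_add_rpow_neg_le (hq : 0 ≤ q) (hx : x ≠ 0) (hxh : 2 * ‖h‖ ≤ ‖x‖) :
    ‖x + h‖ ^ (-q) ≤ 2 ^ q * ‖x‖ ^ (-q) := by
  rw [← norm_div_two_rpow_neg]
  exact Real.rpow_le_rpow_of_nonpos (half_pos (norm_pos_iff.2 hx)) (norm_div_two_le_norm_add hxh)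
    (neg_nonpos.2 hq)

theorem abs_norm_add_rpow_neg_sub_le (hq : 0 ≤ q) (hx : x ≠ 0) (hxh : 2 * ‖h‖ ≤ ‖x‖) :
    |‖x + h‖ ^ (-q) - ‖x‖ ^ (-q)| ≤ q * 2 ^ (q + 1) * ‖h‖ * ‖x‖ ^ (-q - 1) := by
  have hx0 : 0 < ‖x‖ := norm_pos_iff.2 hx
  have hdist : |‖x + h‖ - ‖x‖| ≤ ‖h‖ := by simpa using abs_norm_sub_norm_le (x + h) x
  calc |‖x + h‖ ^ (-q) - ‖x‖ ^ (-q)| ≤ q * (‖x‖ / 2) ^ (-q - 1) * |‖x + h‖ - ‖x‖| :=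
        abs_rpow_neg_sub_rpow_neg_le (half_pos hx0) hq (norm_div_two_le_norm_add hxh)
          (half_le_self hx0.le)
    _ ≤ q * (‖x‖ / 2) ^ (-q - 1) * ‖h‖ := by gcongr
    _ = q * 2 ^ (q + 1) * ‖h‖ * ‖x‖ ^ (-q - 1) := by
        rw [← neg_add', norm_div_two_rpow_neg]; ring

variable [NormedSpace ℝ E] [MeasurableSpace E] {G : Type*} [NormedAddCommGroup G]

/-- A function with a singularity of order `α - d` at the origin of a `d`-dimensional space: it
is of size `|x|^{α-d}`, and it varies under translations as if its gradient were of size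
`|x|^{α-1-d}`. These are the two bounds behind its fractional `L¹` smoothness of order `α`. -/
structure HasPowerSingularity (α A B : ℝ) (F : E → G) (μ : Measure E) : Prop where
  aestronglyMeasurable : AEStronglyMeasurable F μ
  norm_le : ∀ x, ‖F x‖ ≤ A * ‖x‖ ^ (α - finrank ℝ E)
  norm_translate_sub_le : ∀ x h, 2 * ‖h‖ ≤ ‖x‖ →
    ‖F (x + h) - F x‖ ≤ B * ‖h‖ * ‖x‖ ^ (α - 1 - finrank ℝ E)

namespace HasPowerSingularity

variable {μ : Measure E} {α A B : ℝ} {F : E → G}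

theorem norm_translate_sub_le_of_mem_compl_ball (hF : HasPowerSingularity α A B F μ) {h : E} :
    ∀ x ∈ (Metric.ball (0 : E) (2 * ‖h‖))ᶜ,
      ‖F (x + h) - F x‖ ≤ B * ‖h‖ * ‖x‖ ^ (-(1 - α) - finrank ℝ E) := by
  intro x hx
  rw [neg_sub]
  exact hF.norm_translate_sub_le x h (by simpa using hx)

variable [BorelSpace E] [μ.IsAddHaarMeasure]

theorem aestronglyMeasurable_translate_sub (hF : HasPowerSingularity α A B F μ) (h : E) :
    AEStronglyMeasurable (fun x => F (x + h) - F x) μ :=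
  (hF.aestronglyMeasurable.comp_measurePreserving (measurePreserving_add_right μ h)).sub
    hF.aestronglyMeasurable

variable [FiniteDimensional ℝ E] [Nontrivial E]

theorem integrableOn_ball (hF : HasPowerSingularity α A B F μ) (hα : 0 < α) {r : ℝ} (hr : 0 < r) :
    IntegrableOn F (Metric.ball 0 r) μ :=
  (((integrableOn_ball_norm_rpow_iff μ hr).2 (by linarith)).const_mul A).mono'
    hF.aestronglyMeasurable.restrict (Eventually.of_forall hF.norm_le)

theorem setIntegral_ball_norm_le (hF : HasPowerSingularity α A B F μ) (hα : 0 < α) {r : ℝ}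
    (hr : 0 < r) :
    ∫ x in Metric.ball 0 r, ‖F x‖ ∂μ ≤ A * (μ.toSphere.real Set.univ * (r ^ α / α)) := by
  rw [← setIntegral_ball_norm_rpow μ hα hr.le, ← integral_const_mul]
  exact integral_mono (hF.integrableOn_ball hα hr).norm
    (((integrableOn_ball_norm_rpow_iff μ hr).2 (by linarith)).const_mul A) hF.norm_le

theorem integrableOn_ball_translate (hF : HasPowerSingularity α A B F μ) (hα : 0 < α) (h : E)
    {r : ℝ} (hr : 0 < r) : IntegrableOn (fun x => F (x + h)) (Metric.ball 0 r) μ := by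
  have hball : Metric.ball h r ⊆ Metric.ball 0 (‖h‖ + r) :=
    Metric.ball_subset_ball' (by rw [dist_zero_right, add_comm])
  have hint := (hF.integrableOn_ball hα (by positivity)).mono_set hball
  rw [← (measurePreserving_add_right μ h).integrableOn_comp_preimage
    (measurableEmbedding_addRight h)] at hint
  simpa [Function.comp_def] using hint

theorem setIntegral_ball_norm_translate_le (hF : HasPowerSingularity α A B F μ) (hα : 0 < α)
    (h : E) {r : ℝ} (hr : 0 < r) :
    ∫ x in Metric.ball 0 r, ‖F (x + h)‖ ∂μ ≤
      A * (μ.toSphere.real Set.univ * ((‖h‖ + r) ^ α / α)) := by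
  have hball : Metric.ball h r ⊆ Metric.ball 0 (‖h‖ + r) :=
    Metric.ball_subset_ball' (by rw [dist_zero_right, add_comm])
  have htranslate := (measurePreserving_add_right μ h).setIntegral_preimage_emb
    (measurableEmbedding_addRight h) (fun x => ‖F x‖) (Metric.ball h r)
  calc ∫ x in Metric.ball 0 r, ‖F (x + h)‖ ∂μ = ∫ x in Metric.ball h r, ‖F x‖ ∂μ := by
        simpa using htranslate
    _ ≤ ∫ x in Metric.ball 0 (‖h‖ + r), ‖F x‖ ∂μ :=
        setIntegral_mono_set (hF.integrableOn_ball hα (by positivity)).norm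
          (Eventually.of_forall fun _ => norm_nonneg _) hball.eventuallyLE
    _ ≤ A * (μ.toSphere.real Set.univ * ((‖h‖ + r) ^ α / α)) :=
        hF.setIntegral_ball_norm_le hα (by positivity)

theorem integrableOn_compl_ball_translate_sub (hF : HasPowerSingularity α A B F μ) (hα : α < 1)
    {h : E} (hh : h ≠ 0) :
    IntegrableOn (fun x => F (x + h) - F x) (Metric.ball 0 (2 * ‖h‖))ᶜ μ :=
  ((integrableOn_compl_ball_norm_rpow μ (sub_pos.2 hα) (by positivity)).const_mul _).mono'
    (hF.aestronglyMeasurable_translate_sub h).restrict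
    ((ae_restrict_mem measurableSet_ball.compl).mono hF.norm_translate_sub_le_of_mem_compl_ball)

theorem setIntegral_compl_ball_norm_translate_sub_le (hF : HasPowerSingularity α A B F μ)
    (hα : α < 1) {h : E} (hh : h ≠ 0) :
    ∫ x in (Metric.ball 0 (2 * ‖h‖))ᶜ, ‖F (x + h) - F x‖ ∂μ ≤
      B * ‖h‖ * (μ.toSphere.real Set.univ * ((2 * ‖h‖) ^ (-(1 - α)) / (1 - α))) := by
  have hα' : 0 < 1 - α := sub_pos.2 hα
  rw [← setIntegral_compl_ball_norm_rpow μ hα' (by positivity), ← integral_const_mul]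
  exact setIntegral_mono_on (hF.integrableOn_compl_ball_translate_sub hα hh).norm
    ((integrableOn_compl_ball_norm_rpow μ hα' (by positivity)).const_mul _)
    measurableSet_ball.compl hF.norm_translate_sub_le_of_mem_compl_ball

theorem integrable_translate_sub (hF : HasPowerSingularity α A B F μ) (hα : α ∈ Set.Ioo 0 1)
    (h : E) : Integrable (fun x => F (x + h) - F x) μ := by
  rcases eq_or_ne h 0 with rfl | hh
  · simp
  rw [← integrableOn_univ, ← Set.union_compl_self (Metric.ball 0 (2 * ‖h‖))]
  exact ((hF.integrableOn_ball_translate hα.1 h (by positivity)).sub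
    (hF.integrableOn_ball hα.1 (by positivity))).union
    (hF.integrableOn_compl_ball_translate_sub hα.2 hh)

theorem integral_norm_translate_sub_le (hF : HasPowerSingularity α A B F μ)
    (hα : α ∈ Set.Ioo 0 1) {h : E} (hh : h ≠ 0) :
    ∫ x, ‖F (x + h) - F x‖ ∂μ ≤
      A * (μ.toSphere.real Set.univ * ((‖h‖ + 2 * ‖h‖) ^ α / α)) +
        A * (μ.toSphere.real Set.univ * ((2 * ‖h‖) ^ α / α)) +
        B * ‖h‖ * (μ.toSphere.real Set.univ * ((2 * ‖h‖) ^ (-(1 - α)) / (1 - α))) := by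
  have hpos : 0 < 2 * ‖h‖ := by positivity
  have hnear : IntegrableOn (fun x => ‖F (x + h)‖ + ‖F x‖) (Metric.ball 0 (2 * ‖h‖)) μ :=
    (hF.integrableOn_ball_translate hα.1 h hpos).norm.add (hF.integrableOn_ball hα.1 hpos).norm
  calc ∫ x, ‖F (x + h) - F x‖ ∂μ
      = ∫ x in Metric.ball 0 (2 * ‖h‖), ‖F (x + h) - F x‖ ∂μ +
          ∫ x in (Metric.ball 0 (2 * ‖h‖))ᶜ, ‖F (x + h) - F x‖ ∂μ :=
        (integral_add_compl measurableSet_ball (hF.integrable_translate_sub hα h).norm).symm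
    _ ≤ ∫ x in Metric.ball 0 (2 * ‖h‖), (‖F (x + h)‖ + ‖F x‖) ∂μ +
          ∫ x in (Metric.ball 0 (2 * ‖h‖))ᶜ, ‖F (x + h) - F x‖ ∂μ := by
        refine add_le_add (integral_mono ?_ hnear fun x => norm_sub_le _ _) le_rfl
        exact (hF.integrable_translate_sub hα h).norm.integrableOn
    _ ≤ _ := by
        rw [integral_add (hF.integrableOn_ball_translate hα.1 h hpos).norm
          (hF.integrableOn_ball hα.1 hpos).norm]
        exact add_le_add (add_le_add (hF.setIntegral_ball_norm_translate_le hα.1 h hpos)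
          (hF.setIntegral_ball_norm_le hα.1 hpos))
          (hF.setIntegral_compl_ball_norm_translate_sub_le hα.2 hh)

theorem exists_integral_norm_translate_sub_le (hF : HasPowerSingularity α A B F μ)
    (hα : α ∈ Set.Ioo 0 1) :
    ∃ C : ℝ, 0 < C ∧ ∀ h, ∫ x, ‖F (x + h) - F x‖ ∂μ ≤ C * ‖h‖ ^ α := by
  set σ := μ.toSphere.real Set.univ
  set C := σ * (A * (3 ^ α / α) + A * (2 ^ α / α) + B * (2 ^ (-(1 - α)) / (1 - α)))
  refine ⟨|C| + 1, by positivity, fun h => ?_⟩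
  rcases eq_or_ne h 0 with rfl | hh
  · simp [Real.zero_rpow hα.1.ne']
  have hscale : ‖h‖ * ‖h‖ ^ (-(1 - α)) = ‖h‖ ^ α := by
    rw [mul_comm, ← Real.rpow_add_one (norm_ne_zero_iff.2 hh)]
    congr 1; ring
  calc ∫ x, ‖F (x + h) - F x‖ ∂μ
      ≤ A * (σ * ((‖h‖ + 2 * ‖h‖) ^ α / α)) + A * (σ * ((2 * ‖h‖) ^ α / α)) +
          B * ‖h‖ * (σ * ((2 * ‖h‖) ^ (-(1 - α)) / (1 - α))) :=
        hF.integral_norm_translate_sub_le hα hh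
    _ = C * ‖h‖ ^ α := by
        rw [show ‖h‖ + 2 * ‖h‖ = 3 * ‖h‖ by ring, Real.mul_rpow zero_le_three (norm_nonneg h),
          Real.mul_rpow zero_le_two (norm_nonneg h), Real.mul_rpow zero_le_two (norm_nonneg h)]
        simp only [C]
        linear_combination σ * B * (2 ^ (-(1 - α)) / (1 - α)) * hscale
    _ ≤ (|C| + 1) * ‖h‖ ^ α := by
        gcongr
        linarith [le_abs_self C]

end HasPowerSingularity

end PowerSingularity

/-! ### The Riesz kernel -/

section RieszKernel

variable {E : Type*} [NormedAddCommGroup E] [NormedSpace ℝ E] {α : ℝ}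

/-- The kernel `z / |z|^{d+1-α}` on a `d`-dimensional space. Up to a constant it is the gradient of
the Riesz potential of order `1 + α`, and convolution with it inverts the fractional divergence. -/
def rieszKer (α : ℝ) (z : E) : E := ‖z‖ ^ (α - 1 - finrank ℝ E) • z

theorem rieszKer_translate_sub (x h : E) :
    rieszKer α (x + h) - rieszKer α x = ‖x + h‖ ^ (α - 1 - finrank ℝ E) • h +
      (‖x + h‖ ^ (α - 1 - finrank ℝ E) - ‖x‖ ^ (α - 1 - finrank ℝ E)) • x := by
  simp only [rieszKer]; module

theorem measurable_rieszKer [MeasurableSpace E] [BorelSpace E] [SecondCountableTopology E] :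
    Measurable (rieszKer α : E → E) := by
  unfold rieszKer; fun_prop

theorem norm_rieszKer_translate_sub_le (hα : α < 1) {x h : E} (hxh : 2 * ‖h‖ ≤ ‖x‖) :
    ‖rieszKer α (x + h) - rieszKer α x‖ ≤
      (2 ^ (finrank ℝ E + 1 - α) + (finrank ℝ E + 1 - α) * 2 ^ (finrank ℝ E + 1 - α + 1)) * ‖h‖ *
        ‖x‖ ^ (α - 1 - finrank ℝ E) := by
  rcases eq_or_ne x 0 with rfl | hx
  · have : h = 0 := norm_le_zero_iff.1 (by rw [norm_zero] at hxh; linarith)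
    simp [this]
  set q : ℝ := finrank ℝ E + 1 - α with hq
  have hq0 : 0 ≤ q := by
    have : (0 : ℝ) ≤ finrank ℝ E := Nat.cast_nonneg _
    linarith
  have hexp : α - 1 - finrank ℝ E = -q := by rw [hq]; ring
  have hx1 : ‖x‖ ^ (-q - 1) * ‖x‖ = ‖x‖ ^ (-q) := by
    rw [← Real.rpow_add_one (norm_ne_zero_iff.2 hx), sub_add_cancel]
  rw [rieszKer_translate_sub, hexp]
  calc ‖‖x + h‖ ^ (-q) • h + (‖x + h‖ ^ (-q) - ‖x‖ ^ (-q)) • x‖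
      ≤ ‖x + h‖ ^ (-q) * ‖h‖ + |‖x + h‖ ^ (-q) - ‖x‖ ^ (-q)| * ‖x‖ := by
        refine (norm_add_le _ _).trans_eq ?_
        rw [norm_smul, norm_smul, Real.norm_of_nonneg (by positivity), Real.norm_eq_abs]
    _ ≤ 2 ^ q * ‖x‖ ^ (-q) * ‖h‖ + q * 2 ^ (q + 1) * ‖h‖ * ‖x‖ ^ (-q - 1) * ‖x‖ := by
        gcongr
        · exact norm_add_rpow_neg_le hq0 hx hxh
        · exact abs_norm_add_rpow_neg_sub_le hq0 hx hxh
    _ = (2 ^ q + q * 2 ^ (q + 1)) * ‖h‖ * ‖x‖ ^ (-q) := by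
        rw [mul_assoc _ (‖x‖ ^ (-q - 1)), hx1]; ring

variable [FiniteDimensional ℝ E] [Nontrivial E]

theorem norm_rieszKer (hα : α < 1) (z : E) : ‖rieszKer α z‖ = ‖z‖ ^ (α - finrank ℝ E) := by
  have hd : (1 : ℝ) ≤ finrank ℝ E := by exact_mod_cast Module.finrank_pos (R := ℝ) (M := E)
  rcases eq_or_ne z 0 with rfl | hz
  · rw [norm_zero, Real.zero_rpow (by linarith)]; simp [rieszKer]
  · rw [rieszKer, norm_smul, Real.norm_of_nonneg (by positivity),
      ← Real.rpow_add_one (norm_ne_zero_iff.2 hz)]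
    congr 1; ring

theorem hasPowerSingularity_rieszKer [MeasurableSpace E] [BorelSpace E] (hα : α < 1)
    (μ : Measure E) :
    HasPowerSingularity α 1
      (2 ^ (finrank ℝ E + 1 - α) + (finrank ℝ E + 1 - α) * 2 ^ (finrank ℝ E + 1 - α + 1))
      (rieszKer α : E → E) μ where
  aestronglyMeasurable := by
    have := FiniteDimensional.proper ℝ E
    exact measurable_rieszKer.aestronglyMeasurable
  norm_le x := by rw [norm_rieszKer hα, one_mul]
  norm_translate_sub_le _ _ := norm_rieszKer_translate_sub_le hα

theorem locallyIntegrable_rieszKer [MeasurableSpace E] [BorelSpace E] (hα : α ∈ Set.Ioo 0 1)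
    (μ : Measure E) [μ.IsAddHaarMeasure] : LocallyIntegrable (rieszKer α : E → E) μ := by
  intro x
  refine ⟨_, Metric.isOpen_ball.mem_nhds (show x ∈ Metric.ball (0 : E) (‖x‖ + 1) by simp), ?_⟩
  exact (hasPowerSingularity_rieszKer hα.2 μ).integrableOn_ball hα.1 (by positivity)

end RieszKernel

/-! ### The witness belongs to the Besov space -/

section Witness

variable {n : ℕ} {α : ℝ}

theorem besovSeminorm_le_ofReal {f : EuclideanSpace ℝ (Fin n) → ℝ} (hf : Integrable f) {C : ℝ}
    (hC : ∀ h, ∫ x, ‖f (x + h) - f x‖ ≤ C * ‖h‖ ^ α) :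
    besovSeminorm α f ≤ ENNReal.ofReal C := by
  refine iSup₂_le fun h _ => ENNReal.div_le_of_le_mul ?_
  have hint : Integrable (fun x => f (x + h) - f x) := (hf.comp_add_right h).sub hf
  rw [eLpNorm_one_eq_lintegral_enorm, ← ofReal_integral_norm_eq_lintegral_enorm hint,
    ← ENNReal.ofReal_mul' (by positivity)]
  exact ENNReal.ofReal_le_ofReal (hC h)

/-- Profiles of Lipschitz radial cut-offs, equal to `1` on the ball of radius `1 / 2` and to `0`
outside the unit ball. -/
structure IsRadialCutoff (η : ℝ → ℝ) (L : ℝ≥0) : Prop where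
  nonneg : ∀ t, 0 ≤ η t
  le_one : ∀ t, η t ≤ 1
  eq_one : ∀ t, 0 ≤ t → t ≤ 1 / 2 → η t = 1
  eq_zero : ∀ t, 1 < t → η t = 0
  lipschitz : LipschitzWith L η

theorem IsCutoffProfile.isRadialCutoff {η : ℝ → ℝ} (hη : IsCutoffProfile η) :
    IsRadialCutoff η 3 where
  nonneg := hη.nonneg
  le_one := hη.le_one
  eq_one t h0 h1 := hη.eq_one t ⟨by linarith, h1⟩
  eq_zero t ht := by
    by_contra hne
    exact absurd (hη.tsupport_subset (subset_tsupport η hne)).2 (not_le.2 ht)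
  lipschitz := hη.lipschitz

theorem isRadialCutoff_piecewiseLinear :
    IsRadialCutoff (fun t => max 0 (min 1 (2 - 2 * t))) 2 where
  nonneg t := le_max_left _ _
  le_one t := max_le zero_le_one (min_le_left _ _)
  eq_one t _ h1 := by
    rw [min_eq_left (by linarith), max_eq_right zero_le_one]
  eq_zero t ht := by
    rw [min_eq_right (by linarith), max_eq_left (by linarith)]
  lipschitz := by
    have h : LipschitzWith 2 (fun t : ℝ => 2 - 2 * t) :=
      LipschitzWith.of_dist_le_mul fun s t => by
        rw [Real.dist_eq, Real.dist_eq, show 2 - 2 * s - (2 - 2 * t) = (-2) * (s - t) by ring,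
          abs_mul]
        norm_num
    exact (h.const_min 1).const_max 0

variable {η : ℝ → ℝ} {L : ℝ≥0}

theorem IsRadialCutoff.abs_norm_add_sub_mul_norm_le (hη : IsRadialCutoff η L) {E : Type*}
    [NormedAddCommGroup E] {x h : E} (hxh : 2 * ‖h‖ ≤ ‖x‖) :
    |η ‖x + h‖ - η ‖x‖| * ‖x‖ ≤ 2 * L * ‖h‖ := by
  rcases le_or_gt ‖x‖ 2 with hx | hx
  · have hlip : |η ‖x + h‖ - η ‖x‖| ≤ L * ‖h‖ := by
      refine (hη.lipschitz.dist_le_mul ‖x + h‖ ‖x‖).trans ?_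
      gcongr
      simpa [Real.dist_eq] using abs_norm_sub_norm_le (x + h) x
    calc |η ‖x + h‖ - η ‖x‖| * ‖x‖ ≤ L * ‖h‖ * 2 := by gcongr
      _ = 2 * L * ‖h‖ := by ring
  · have := norm_div_two_le_norm_add hxh
    rw [hη.eq_zero ‖x‖ (by linarith), hη.eq_zero ‖x + h‖ (by linarith), sub_self, abs_zero,
      zero_mul]
    positivity

theorem witness_apply (x : EuclideanSpace ℝ (Fin n)) :
    witness n α η x = η ‖x‖ * ‖x‖ ^ (α - n) := by
  rw [witness, cutoff, div_one]

theorem measurable_witness (hη : IsRadialCutoff η L) : Measurable (witness n α η) := by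
  have : Measurable η := hη.lipschitz.continuous.measurable
  rw [funext (witness_apply (n := n) (α := α) (η := η))]
  fun_prop

theorem witness_nonneg (hη : IsRadialCutoff η L) (x : EuclideanSpace ℝ (Fin n)) :
    0 ≤ witness n α η x := by
  rw [witness_apply]
  exact mul_nonneg (hη.nonneg _) (by positivity)

theorem witness_le_rpow (hη : IsRadialCutoff η L) (x : EuclideanSpace ℝ (Fin n)) :
    witness n α η x ≤ ‖x‖ ^ (α - n) := by
  rw [witness_apply]
  exact mul_le_of_le_one_left (by positivity) (hη.le_one _)

theorem witness_eq_rpow (hη : IsRadialCutoff η L) {x : EuclideanSpace ℝ (Fin n)}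
    (hx : ‖x‖ ≤ 1 / 2) : witness n α η x = ‖x‖ ^ (α - n) := by
  rw [witness_apply, hη.eq_one _ (norm_nonneg _) hx, one_mul]

theorem witness_eq_zero (hη : IsRadialCutoff η L) {x : EuclideanSpace ℝ (Fin n)} (hx : 1 < ‖x‖) :
    witness n α η x = 0 := by
  rw [witness_apply, hη.eq_zero _ hx, zero_mul]

theorem norm_witness_translate_sub_le (hα : α ≤ n) (hη : IsRadialCutoff η L)
    {x h : EuclideanSpace ℝ (Fin n)} (hxh : 2 * ‖h‖ ≤ ‖x‖) :
    ‖witness n α η (x + h) - witness n α η x‖ ≤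
      ((n - α) * 2 ^ (n - α + 1) + 2 * L) * ‖h‖ * ‖x‖ ^ (α - 1 - n) := by
  rcases eq_or_ne x 0 with rfl | hx
  · have : h = 0 := norm_le_zero_iff.1 (by rw [norm_zero] at hxh; linarith)
    simp [this]
  set q : ℝ := n - α with hq
  have hq0 : 0 ≤ q := sub_nonneg.2 hα
  have hx1 : ‖x‖ ^ (-q) = ‖x‖ ^ (-q - 1) * ‖x‖ := by
    rw [← Real.rpow_add_one (norm_ne_zero_iff.2 hx), sub_add_cancel]
  have hsplit : witness n α η (x + h) - witness n α η x =
      η ‖x + h‖ * (‖x + h‖ ^ (-q) - ‖x‖ ^ (-q)) + (η ‖x + h‖ - η ‖x‖) * ‖x‖ ^ (-q) := by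
    rw [witness_apply, witness_apply, hq, neg_sub]; ring
  rw [hsplit, show α - 1 - n = -q - 1 by rw [hq]; ring, Real.norm_eq_abs]
  calc |η ‖x + h‖ * (‖x + h‖ ^ (-q) - ‖x‖ ^ (-q)) + (η ‖x + h‖ - η ‖x‖) * ‖x‖ ^ (-q)|
      ≤ η ‖x + h‖ * |‖x + h‖ ^ (-q) - ‖x‖ ^ (-q)| +
          |η ‖x + h‖ - η ‖x‖| * ‖x‖ * ‖x‖ ^ (-q - 1) := by
        refine (abs_add_le _ _).trans_eq ?_
        rw [abs_mul, abs_mul, abs_of_nonneg (hη.nonneg _),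
          abs_of_nonneg (by positivity : 0 ≤ ‖x‖ ^ (-q)), hx1]
        ring
    _ ≤ 1 * (q * 2 ^ (q + 1) * ‖h‖ * ‖x‖ ^ (-q - 1)) + 2 * L * ‖h‖ * ‖x‖ ^ (-q - 1) := by
        gcongr ?_ * ?_ + ?_ * _
        · exact hη.le_one _
        · exact abs_norm_add_rpow_neg_sub_le hq0 hx hxh
        · exact hη.abs_norm_add_sub_mul_norm_le hxh
    _ = (q * 2 ^ (q + 1) + 2 * L) * ‖h‖ * ‖x‖ ^ (-q - 1) := by ring

theorem hasPowerSingularity_witness (hα : α ≤ n) (hη : IsRadialCutoff η L) :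
    HasPowerSingularity α 1 ((n - α) * 2 ^ (n - α + 1) + 2 * L) (witness n α η) volume where
  aestronglyMeasurable := (measurable_witness hη).aestronglyMeasurable
  norm_le x := by
    rw [finrank_euclideanSpace_fin, one_mul, Real.norm_of_nonneg (witness_nonneg hη x)]
    exact witness_le_rpow hη x
  norm_translate_sub_le x h hxh := by
    rw [finrank_euclideanSpace_fin]
    exact norm_witness_translate_sub_le hα hη hxh

variable [NeZero n]

theorem integrable_witness (hα : α ∈ Set.Ioc (0 : ℝ) n) (hη : IsRadialCutoff η L) :
    Integrable (witness n α η) := by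
  refine (integrableOn_iff_integrable_of_support_subset fun x hx => ?_).1
    ((hasPowerSingularity_witness hα.2 hη).integrableOn_ball hα.1 two_pos)
  by_contra hx2
  rw [mem_ball_zero_iff, not_lt] at hx2
  exact hx (witness_eq_zero hη (by linarith))

theorem witness_mem_BesovSpace (hα : α ∈ Set.Ioo 0 1) (hη : IsRadialCutoff η L) :
    witness n α η ∈ BesovSpace n α := by
  have hn : α ≤ n := hα.2.le.trans (by exact_mod_cast NeZero.one_le)
  have hint := integrable_witness ⟨hα.1, hn⟩ hη
  obtain ⟨C, -, hC⟩ :=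
    (hasPowerSingularity_witness hn hη).exists_integral_norm_translate_sub_le hα
  exact ⟨memLp_one_iff_integrable.2 hint,
    (besovSeminorm_le_ofReal hint hC).trans_lt ENNReal.ofReal_lt_top⟩

theorem not_memLp_witness (hα : α < n) (hη : IsRadialCutoff η L) :
    ¬ MemLp (witness n α η) (ENNReal.ofReal (n / (n - α))) volume := by
  intro hmem
  have hn : (0 : ℝ) < n := by exact_mod_cast NeZero.pos n
  have hp : 0 < n / (n - α) := div_pos hn (sub_pos.2 hα)
  have hpow := (hmem.integrable_norm_rpow (by simpa using hp) ENNReal.ofReal_ne_top).integrableOn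
    (s := Metric.ball 0 (1 / 2))
  rw [ENNReal.toReal_ofReal hp.le] at hpow
  have hrpow : IntegrableOn (fun x : EuclideanSpace ℝ (Fin n) => ‖x‖ ^ (-(n : ℝ)))
      (Metric.ball 0 (1 / 2)) := by
    refine hpow.congr_fun (fun x hx => ?_) measurableSet_ball
    simp only
    rw [Real.norm_of_nonneg (witness_nonneg hη x),
      witness_eq_rpow hη (mem_ball_zero_iff.1 hx).le, ← Real.rpow_mul (norm_nonneg _)]
    have : n - α ≠ 0 := (sub_pos.2 hα).ne'
    congr 1
    field_simp
    ring
  rw [integrableOn_ball_norm_rpow_iff volume (by norm_num)] at hrpow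
  simp at hrpow

end Witness

/-! ### The principal value defining the fractional divergence -/

section PrincipalValue

variable {E : Type*} [NormedAddCommGroup E] {α ε : ℝ}

theorem measurableSet_setOf_lt_norm [MeasurableSpace E] [OpensMeasurableSpace E] (ε : ℝ) :
    MeasurableSet {y : E | ε < ‖y‖} :=
  measurableSet_lt measurable_const measurable_norm

theorem integral_eq_zero_of_odd [MeasurableSpace E] [MeasurableNeg E] (μ : Measure E)
    [μ.IsNegInvariant] {F : E → ℝ} (hF : ∀ y, F (-y) = -F y) : ∫ y, F y ∂μ = 0 := by
  have hneg := integral_neg_eq_self F μ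
  simp only [hF, integral_neg] at hneg
  linarith

theorem setIntegral_lt_norm_eq_zero_of_odd [MeasurableSpace E] [BorelSpace E] (μ : Measure E)
    [μ.IsNegInvariant] {F : E → ℝ} (hF : ∀ y, F (-y) = -F y) :
    ∫ y in {y | ε < ‖y‖}, F y ∂μ = 0 := by
  rw [← integral_indicator (measurableSet_setOf_lt_norm ε)]
  refine integral_eq_zero_of_odd μ fun y => ?_
  by_cases hy : ε < ‖y‖ <;> simp [hy, hF]

variable [InnerProductSpace ℝ E]

/-- The integrand `y · v / |y|^{d+α+1}` of the fractional divergence. -/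
def divKer (α : ℝ) (y v : E) : ℝ := inner ℝ y v / ‖y‖ ^ (finrank ℝ E + α + 1)

theorem divKer_sub (y v w : E) : divKer α y (v - w) = divKer α y v - divKer α y w := by
  simp only [divKer, inner_sub_right, sub_div]

theorem divKer_neg_left (y v : E) : divKer α (-y) v = -divKer α y v := by
  simp only [divKer, inner_neg_left, norm_neg, neg_div]

theorem norm_divKer_le (y v : E) : ‖divKer α y v‖ ≤ ‖v‖ * ‖y‖ ^ (-α - finrank ℝ E) := by
  rcases eq_or_ne y 0 with rfl | hy
  · simp only [divKer, inner_zero_left, zero_div, norm_zero]; positivity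
  have hy0 : 0 < ‖y‖ := norm_pos_iff.2 hy
  rw [divKer, norm_div, Real.norm_of_nonneg (by positivity : 0 ≤ ‖y‖ ^ (finrank ℝ E + α + 1)),
    div_le_iff₀ (by positivity), mul_assoc, ← Real.rpow_add hy0,
    show -α - finrank ℝ E + (finrank ℝ E + α + 1) = 1 by ring, Real.rpow_one, mul_comm]
  exact norm_inner_le_norm _ _

/-- A radial majorant of `y ↦ divKer α y (φ (x + y) - φ x)` for a field `φ` bounded by `M` with
Lipschitz constant `K`: the Lipschitz bound is used for `|y| < 1`, boundedness for `|y| ≥ 1`. -/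
def divMajorant (α M : ℝ) (K : ℝ≥0) (y : E) : ℝ :=
  (Metric.ball 0 1).indicator (fun y : E => K * ‖y‖ ^ (1 - α - finrank ℝ E)) y +
    (Metric.ball 0 1)ᶜ.indicator (fun y : E => 2 * M * ‖y‖ ^ (-α - finrank ℝ E)) y

/-- Fields bounded by `M` with Lipschitz constant `K`, on which the principal value converges. -/
structure IsBddLip (φ : E → E) (M : ℝ) (K : ℝ≥0) : Prop where
  norm_le : ∀ x, ‖φ x‖ ≤ M
  lipschitz : LipschitzWith K φ

variable {φ ψ : E → E} {M : ℝ} {K : ℝ≥0}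

theorem norm_divKer_sub_le (hφ : IsBddLip φ M K) (x y : E) :
    ‖divKer α y (φ (x + y) - φ x)‖ ≤ divMajorant α M K y := by
  refine (norm_divKer_le _ _).trans ?_
  rcases eq_or_ne y 0 with rfl | hy
  · have : 0 ≤ K * ‖(0 : E)‖ ^ (1 - α - finrank ℝ E) := by positivity
    simpa [divMajorant] using this
  by_cases h1 : ‖y‖ < 1
  · have hlip : ‖φ (x + y) - φ x‖ ≤ K * ‖y‖ := by
      simpa only [add_sub_cancel_left] using hφ.lipschitz.norm_sub_le (x + y) x
    simp only [divMajorant, Set.indicator, mem_ball_zero_iff, h1, if_true, Set.mem_compl_iff,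
      not_true, if_false, add_zero]
    calc ‖φ (x + y) - φ x‖ * ‖y‖ ^ (-α - finrank ℝ E)
        ≤ K * ‖y‖ * ‖y‖ ^ (-α - finrank ℝ E) := by gcongr
      _ = K * ‖y‖ ^ (1 - α - finrank ℝ E) := by
        rw [show 1 - α - finrank ℝ E = (-α - finrank ℝ E) + 1 by ring,
          Real.rpow_add_one (norm_ne_zero_iff.2 hy)]
        ring
  · simp only [divMajorant, Set.indicator, mem_ball_zero_iff, h1, if_false, Set.mem_compl_iff,
      not_false_eq_true, if_true, zero_add]
    gcongr
    linarith [norm_sub_le (φ (x + y)) (φ x), hφ.norm_le x, hφ.norm_le (x + y)]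

variable [MeasurableSpace E] [BorelSpace E] [FiniteDimensional ℝ E]

/-- The truncated fractional divergence, without its normalising constant. -/
def truncDiv (α ε : ℝ) (φ : E → E) (x : E) : ℝ :=
  ∫ y in {y | ε < ‖y‖}, divKer α y (φ (x + y))

/-- The principal value `lim_{ε → 0} truncDiv α ε φ`, written as an absolutely convergent integral:
the kernel is odd, so `φ x` may be subtracted from `φ (x + y)`. -/
def pvDiv (α : ℝ) (φ : E → E) (x : E) : ℝ :=
  ∫ y, divKer α y (φ (x + y) - φ x)

theorem measurable_divKer (hψ : Measurable ψ) : Measurable fun y => divKer α y (ψ y) := by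
  have := FiniteDimensional.proper ℝ E
  unfold divKer; fun_prop

variable [Nontrivial E]

theorem integrable_divMajorant (hα : α ∈ Set.Ioo 0 1) (M : ℝ) (K : ℝ≥0) :
    Integrable (divMajorant α M K : E → ℝ) := by
  refine Integrable.add ?_ ?_
  · refine (integrable_indicator_iff measurableSet_ball).2 (Integrable.const_mul ?_ _)
    exact (integrableOn_ball_norm_rpow_iff volume one_pos).2 (by linarith [hα.2])
  · refine (integrable_indicator_iff measurableSet_ball.compl).2 (Integrable.const_mul ?_ _)
    exact integrableOn_compl_ball_norm_rpow volume hα.1 one_pos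

theorem integrableOn_lt_norm_rpow (hα : 0 < α) (hε : 0 < ε) :
    IntegrableOn (fun y : E => ‖y‖ ^ (-α - finrank ℝ E)) {y | ε < ‖y‖} :=
  (integrableOn_compl_ball_norm_rpow volume hα hε).mono_set fun y hy => by
    simpa using (Set.mem_ofPred.1 hy).le

theorem integrableOn_divKer (hα : 0 < α) (hε : 0 < ε) (hψ : Measurable ψ)
    (hM : ∀ x, ‖ψ x‖ ≤ M) : IntegrableOn (fun y => divKer α y (ψ y)) {y | ε < ‖y‖} := by
  refine ((integrableOn_lt_norm_rpow hα hε).const_mul M).mono'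
    (measurable_divKer hψ).aestronglyMeasurable
    (Eventually.of_forall fun y => (norm_divKer_le _ _).trans ?_)
  gcongr
  exact hM y

theorem integrable_divKer_sub (hα : α ∈ Set.Ioo 0 1) (hφ : IsBddLip φ M K) (x : E) :
    Integrable fun y => divKer α y (φ (x + y) - φ x) := by
  have := hφ.lipschitz.continuous
  refine (integrable_divMajorant hα M K).mono' ?_ (Eventually.of_forall (norm_divKer_sub_le hφ x))
  exact (measurable_divKer (ψ := fun y => φ (x + y) - φ x)
    (Continuous.measurable (by fun_prop))).aestronglyMeasurable

theorem truncDiv_eq_setIntegral_sub (hα : 0 < α) (hφ : IsBddLip φ M K) (hε : 0 < ε) (x : E) :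
    truncDiv α ε φ x = ∫ y in {y | ε < ‖y‖}, divKer α y (φ (x + y) - φ x) := by
  have := hφ.lipschitz.continuous
  simp only [divKer_sub]
  rw [integral_sub, setIntegral_lt_norm_eq_zero_of_odd volume (F := fun y => divKer α y (φ x))
    fun y => divKer_neg_left y _, sub_zero, truncDiv]
  · exact integrableOn_divKer hα hε (ψ := fun y => φ (x + y)) (Continuous.measurable (by fun_prop))
      fun y => hφ.norm_le _
  · exact integrableOn_divKer hα hε measurable_const fun _ => hφ.norm_le x

theorem norm_truncDiv_le (hα : α ∈ Set.Ioo 0 1) (hφ : IsBddLip φ M K) (hε : 0 < ε) (x : E) :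
    ‖truncDiv α ε φ x‖ ≤ ∫ y : E, divMajorant α M K y := by
  rw [truncDiv_eq_setIntegral_sub hα.1 hφ hε,
    ← integral_indicator (measurableSet_setOf_lt_norm ε)]
  exact norm_integral_le_of_norm_le (integrable_divMajorant hα M K) (Eventually.of_forall fun y =>
    (norm_indicator_le_norm_self _ _).trans (norm_divKer_sub_le hφ x y))

theorem norm_pvDiv_le (hα : α ∈ Set.Ioo 0 1) (hφ : IsBddLip φ M K) (x : E) :
    ‖pvDiv α φ x‖ ≤ ∫ y : E, divMajorant α M K y :=
  norm_integral_le_of_norm_le (integrable_divMajorant hα M K)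
    (Eventually.of_forall (norm_divKer_sub_le hφ x))

theorem tendsto_truncDiv (hα : α ∈ Set.Ioo 0 1) (hφ : IsBddLip φ M K) (x : E) :
    Tendsto (fun ε => truncDiv α ε φ x) (𝓝[>] 0) (𝓝 (pvDiv α φ x)) := by
  have h : Tendsto (fun ε => ∫ y, {y | ε < ‖y‖}.indicator
      (fun y => divKer α y (φ (x + y) - φ x)) y) (𝓝[>] (0 : ℝ)) (𝓝 (pvDiv α φ x)) := by
    refine tendsto_integral_filter_of_dominated_convergence (divMajorant α M K)
      (Eventually.of_forall fun ε => ?_) (Eventually.of_forall fun ε => ?_)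
      (integrable_divMajorant hα M K) (Eventually.of_forall fun y => ?_)
    · exact (integrable_divKer_sub hα hφ x).aestronglyMeasurable.indicator
        (measurableSet_setOf_lt_norm ε)
    · exact Eventually.of_forall fun y =>
        (norm_indicator_le_norm_self _ _).trans (norm_divKer_sub_le hφ x y)
    · rcases eq_or_ne y 0 with rfl | hy
      · simp [divKer, Set.indicator]
      · refine tendsto_const_nhds.congr' ?_
        filter_upwards [nhdsWithin_le_nhds (Iio_mem_nhds (norm_pos_iff.2 hy))] with ε hε
        simp [Set.indicator, Set.mem_Iio.1 hε]
  refine h.congr' ?_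
  filter_upwards [self_mem_nhdsWithin] with ε hε
  rw [truncDiv_eq_setIntegral_sub hα.1 hφ hε, integral_indicator (measurableSet_setOf_lt_norm ε)]

theorem continuous_truncDiv (hα : 0 < α) (hφ : IsBddLip φ M K) (hε : 0 < ε) :
    Continuous (truncDiv α ε φ) := by
  have := hφ.lipschitz.continuous
  refine continuous_of_dominated (fun x => ?_) (fun x => ?_)
    ((integrableOn_lt_norm_rpow hα hε).const_mul M) (Eventually.of_forall fun y => ?_)
  · exact (measurable_divKer (ψ := fun y => φ (x + y))
      (Continuous.measurable (by fun_prop))).aestronglyMeasurable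
  · refine Eventually.of_forall fun y => (norm_divKer_le _ _).trans ?_
    gcongr
    exact hφ.norm_le _
  · unfold divKer; fun_prop

theorem continuous_pvDiv (hα : α ∈ Set.Ioo 0 1) (hφ : IsBddLip φ M K) :
    Continuous (pvDiv α φ) := by
  have := hφ.lipschitz.continuous
  refine continuous_of_dominated (fun x => (integrable_divKer_sub hα hφ x).aestronglyMeasurable)
    (fun x => Eventually.of_forall (norm_divKer_sub_le hφ x)) (integrable_divMajorant hα M K)
    (Eventually.of_forall fun y => ?_)
  unfold divKer; fun_prop

variable {f : E → ℝ}

theorem tendsto_integral_mul_truncDiv (hα : α ∈ Set.Ioo 0 1) (hφ : IsBddLip φ M K)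
    (hf : Integrable f) :
    Tendsto (fun ε => ∫ x, f x * truncDiv α ε φ x) (𝓝[>] 0) (𝓝 (∫ x, f x * pvDiv α φ x)) := by
  refine tendsto_integral_filter_of_dominated_convergence
    (fun x => ‖f x‖ * ∫ y : E, divMajorant α M K y) ?_ ?_ (hf.norm.mul_const _)
    (Eventually.of_forall fun x => (tendsto_truncDiv hα hφ x).const_mul _)
  · filter_upwards [self_mem_nhdsWithin] with ε hε
    exact hf.aestronglyMeasurable.mul (continuous_truncDiv hα.1 hφ hε).aestronglyMeasurable
  · filter_upwards [self_mem_nhdsWithin] with ε hε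
    refine Eventually.of_forall fun x => ?_
    rw [norm_mul]
    gcongr
    exact norm_truncDiv_le hα hφ hε x

theorem integrable_mul_divKer_prod (hα : 0 < α) (hφ : IsBddLip φ M K) (hf : Integrable f)
    (hfm : Measurable f) (hε : 0 < ε) :
    Integrable (fun z : E × E => f z.1 * divKer α z.2 (φ (z.1 + z.2)))
      (volume.prod (volume.restrict {y | ε < ‖y‖})) := by
  have hφm : Measurable φ := hφ.lipschitz.continuous.measurable
  refine (hf.norm.mul_prod ((integrableOn_lt_norm_rpow hα hε).const_mul M)).mono' ?_
    (Eventually.of_forall fun z => ?_)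
  · unfold divKer
    exact Measurable.aestronglyMeasurable (by fun_prop)
  · rw [norm_mul]
    gcongr
    refine (norm_divKer_le _ _).trans ?_
    gcongr
    exact hφ.norm_le _

theorem integrable_translate_mul_divKer_prod (hα : 0 < α) (hφ : IsBddLip φ M K)
    (hf : Integrable f) (hfm : Measurable f) (hε : 0 < ε) :
    Integrable (fun z : E × E => f (z.1 - z.2) * divKer α z.2 (φ z.1))
      (volume.prod (volume.restrict {y | ε < ‖y‖})) := by
  have hφm : Measurable φ := hφ.lipschitz.continuous.measurable
  have hprod := integrable_mul_divKer_prod hα hφ hf hfm hε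
  have hmeas : AEStronglyMeasurable (fun z : E × E => f (z.1 - z.2) * divKer α z.2 (φ z.1))
      (volume.prod (volume.restrict {y | ε < ‖y‖})) := by
    unfold divKer
    exact Measurable.aestronglyMeasurable (by fun_prop)
  rw [integrable_prod_iff' hmeas]
  constructor
  · filter_upwards [hprod.prod_left_ae] with y hy
    simpa using hy.comp_sub_right y
  · refine hprod.integral_norm_prod_right.congr (Eventually.of_forall fun y => ?_)
    have htranslate := integral_add_right_eq_self (μ := volume)
      (fun x => ‖f (x - y) * divKer α y (φ x)‖) y
    simpa only [add_sub_cancel_right] using htranslate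

theorem integral_mul_truncDiv (hα : 0 < α) (hφ : IsBddLip φ M K) (hf : Integrable f)
    (hfm : Measurable f) (hε : 0 < ε) :
    ∫ x, f x * truncDiv α ε φ x = ∫ x, ∫ y in {y | ε < ‖y‖}, f (x - y) * divKer α y (φ x) := by
  have htranslate (y : E) :
      ∫ x, f x * divKer α y (φ (x + y)) = ∫ x, f (x - y) * divKer α y (φ x) := by
    rw [← integral_add_right_eq_self (μ := volume) (fun x => f (x - y) * divKer α y (φ x)) y]
    simp only [add_sub_cancel_right]
  calc ∫ x, f x * truncDiv α ε φ x
      = ∫ x, ∫ y in {y | ε < ‖y‖}, f x * divKer α y (φ (x + y)) := by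
        simp only [integral_const_mul, truncDiv]
    _ = ∫ y in {y | ε < ‖y‖}, ∫ x, f x * divKer α y (φ (x + y)) :=
        integral_integral_swap (integrable_mul_divKer_prod hα hφ hf hfm hε)
    _ = ∫ y in {y | ε < ‖y‖}, ∫ x, f (x - y) * divKer α y (φ x) := by simp only [htranslate]
    _ = ∫ x, ∫ y in {y | ε < ‖y‖}, f (x - y) * divKer α y (φ x) :=
        (integral_integral_swap (integrable_translate_mul_divKer_prod hα hφ hf hfm hε)).symm

end PrincipalValue

section FracDiv

variable {n : ℕ} {α M : ℝ} {φ : EuclideanSpace ℝ (Fin n) → EuclideanSpace ℝ (Fin n)} {K : ℝ≥0}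

theorem muConst_pos (hα : α ∈ Set.Ioo 0 1) : 0 < muConst n α := by
  have hα0 := hα.1
  have : 0 < Real.Gamma ((n + α + 1) / 2) := Real.Gamma_pos_of_pos (by positivity)
  have : 0 < Real.Gamma ((1 - α) / 2) := Real.Gamma_pos_of_pos (by linarith [hα.2])
  unfold muConst; positivity

theorem fracDiv_eq [NeZero n] (hα : α ∈ Set.Ioo 0 1) (hφ : IsBddLip φ M K)
    (x : EuclideanSpace ℝ (Fin n)) : fracDiv α φ x = muConst n α * pvDiv α φ x := by
  have hlim := (tendsto_truncDiv hα hφ x).limUnder_eq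
  simp only [truncDiv, divKer, finrank_euclideanSpace_fin] at hlim
  rw [fracDiv, hlim]

theorem IsTestField.exists_isBddLip (hφ : IsTestField φ) : ∃ K, IsBddLip φ 1 K := by
  obtain ⟨K, hK⟩ := hφ.smooth.lipschitzWith_of_hasCompactSupport hφ.compactSupport (by simp)
  exact ⟨K, hφ.norm_le_one, hK⟩

end FracDiv

/-! ### The witness has infinite variation -/

section PowerAsymmetry

variable {E : Type*} [NormedAddCommGroup E] [InnerProductSpace ℝ E] {α ε : ℝ} {x y : E}

theorem norm_sub_le_norm_add_iff_inner_nonneg : ‖x - y‖ ≤ ‖x + y‖ ↔ 0 ≤ inner ℝ y x := by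
  rw [← sq_le_sq₀ (norm_nonneg _) (norm_nonneg _), norm_sub_sq_real, norm_add_sq_real,
    real_inner_comm]
  constructor <;> intro h <;> linarith

theorem divKer_smul (c : ℝ) (y v : E) : divKer α y (c • v) = c * divKer α y v := by
  simp only [divKer, inner_smul_right, mul_div_assoc]

theorem rpow_norm_sub_sub_mul_divKer_nonneg (hα : α ≤ finrank ℝ E) (h₁ : y ≠ x) (h₂ : y ≠ -x) :
    0 ≤ (‖x - y‖ ^ (α - finrank ℝ E) - ‖x + y‖ ^ (α - finrank ℝ E)) *
      divKer α y (‖x‖⁻¹ • x) := by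
  have hsub : 0 < ‖x - y‖ := norm_pos_iff.2 (sub_ne_zero.2 h₁.symm)
  have hadd : 0 < ‖x + y‖ :=
    norm_pos_iff.2 fun h => h₂ (by rw [eq_neg_iff_add_eq_zero, add_comm, h])
  rw [divKer_smul, divKer]
  rcases le_total 0 (inner ℝ y x) with h | h
  · have := Real.rpow_le_rpow_of_nonpos hsub (norm_sub_le_norm_add_iff_inner_nonneg.2 h)
      (sub_nonpos.2 hα)
    exact mul_nonneg (by linarith) (by positivity)
  · have hle : ‖x + y‖ ≤ ‖x - y‖ := by
      rw [← sub_neg_eq_add, sub_eq_add_neg x y]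
      exact norm_sub_le_norm_add_iff_inner_nonneg.2 (by simpa using h)
    have := Real.rpow_le_rpow_of_nonpos hadd hle (sub_nonpos.2 hα)
    refine mul_nonneg_of_nonpos_of_nonpos (by linarith) ?_
    exact mul_nonpos_of_nonneg_of_nonpos (by positivity)
      (div_nonpos_of_nonpos_of_nonneg h (by positivity))

theorem rpow_norm_sub_sub_rpow_norm_add_ge (hα : α ≤ finrank ℝ E) (hyx : y ≠ x)
    (hy : ‖y - x‖ < ‖x‖ / 2) :
    (2 ^ (finrank ℝ E - α) - 1) * ‖x‖ ^ (α - finrank ℝ E) ≤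
      ‖x - y‖ ^ (α - finrank ℝ E) - ‖x + y‖ ^ (α - finrank ℝ E) := by
  have hx : 0 < ‖x‖ := by linarith [norm_nonneg (y - x)]
  have hnear : ‖x - y‖ ≤ ‖x‖ / 2 := by rw [norm_sub_rev]; exact hy.le
  have hfar : ‖x‖ ≤ ‖x + y‖ := by
    have h := norm_sub_norm_le ((2 : ℝ) • x) (-(y - x))
    rw [show (2 : ℝ) • x - -(y - x) = x + y by module, norm_neg, norm_smul, Real.norm_two] at h
    linarith
  have h₁ := Real.rpow_le_rpow_of_nonpos (norm_pos_iff.2 (sub_ne_zero.2 hyx.symm)) hnear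
    (sub_nonpos.2 hα)
  have h₂ := Real.rpow_le_rpow_of_nonpos hx hfar (sub_nonpos.2 hα)
  rw [← neg_sub (finrank ℝ E : ℝ) α, norm_div_two_rpow_neg, neg_sub] at h₁
  linarith

theorem divKer_inv_norm_smul_ge (hα : 0 ≤ α) (hy : ‖y - x‖ < ‖x‖ / 2) :
    1 / 2 * ‖x‖ * (3 / 2 * ‖x‖) ^ (-(finrank ℝ E + α + 1)) ≤ divKer α y (‖x‖⁻¹ • x) := by
  have : (0 : ℝ) ≤ finrank ℝ E := Nat.cast_nonneg _
  have hx : 0 < ‖x‖ := by linarith [norm_nonneg (y - x)]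
  have hyle : ‖y‖ ≤ 3 / 2 * ‖x‖ := by linarith [norm_sub_norm_le y x]
  have hy0 : 0 < ‖y‖ := by linarith [norm_sub_norm_le x y, norm_sub_rev x y]
  have hinner : 1 / 2 * ‖x‖ ≤ ‖x‖⁻¹ * inner ℝ y x := by
    have h : inner ℝ y x = ‖x‖ ^ 2 + inner ℝ (y - x) x := by
      rw [inner_sub_left, real_inner_self_eq_norm_sq]; ring
    rw [inv_mul_eq_div, le_div_iff₀ hx]
    nlinarith [(abs_le.1 (abs_real_inner_le_norm (y - x) x)).1]
  rw [divKer_smul, divKer, ← mul_div_assoc, div_eq_mul_inv (_ * _), ← Real.rpow_neg (norm_nonneg y)]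
  gcongr ?_ * ?_
  · exact (by positivity : 0 ≤ 1 / 2 * ‖x‖).trans hinner
  · exact Real.rpow_le_rpow_of_nonpos hy0 hyle (by linarith)

theorem exists_le_rpow_norm_sub_sub_mul_divKer (hα : α ∈ Set.Ico (0 : ℝ) (finrank ℝ E)) :
    ∃ c : ℝ, 0 < c ∧ ∀ x y : E, y ≠ x → ‖y - x‖ < ‖x‖ / 2 →
      c * ‖x‖ ^ (-(2 * finrank ℝ E : ℝ)) ≤
        (‖x - y‖ ^ (α - finrank ℝ E) - ‖x + y‖ ^ (α - finrank ℝ E)) *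
          divKer α y (‖x‖⁻¹ • x) := by
  set d : ℝ := (finrank ℝ E : ℝ)
  have hpow : 0 < (2 : ℝ) ^ (d - α) - 1 :=
    sub_pos.2 (Real.one_lt_rpow one_lt_two (sub_pos.2 hα.2))
  refine ⟨(2 ^ (d - α) - 1) * (1 / 2 * (3 / 2) ^ (-(d + α + 1))), by positivity, ?_⟩
  intro x y hyx hy
  have hx : 0 < ‖x‖ := by linarith [norm_nonneg (y - x)]
  have hscale : ‖x‖ ^ (α - d) * (‖x‖ * ‖x‖ ^ (-(d + α + 1))) = ‖x‖ ^ (-(2 * d)) := by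
    rw [← Real.rpow_one_add' hx.le (by linarith [hα.1, hα.2]), ← Real.rpow_add hx]
    congr 1; ring
  calc _ = (2 ^ (d - α) - 1) * ‖x‖ ^ (α - d) *
        (1 / 2 * ‖x‖ * (3 / 2 * ‖x‖) ^ (-(d + α + 1))) := by
        rw [← hscale, Real.mul_rpow (by norm_num) hx.le]; ring
    _ ≤ _ := mul_le_mul (rpow_norm_sub_sub_rpow_norm_add_ge hα.2.le hyx hy)
        (divKer_inv_norm_smul_ge hα.1 hy) (by positivity)
        (le_trans (by positivity) (rpow_norm_sub_sub_rpow_norm_add_ge hα.2.le hyx hy))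

theorem norm_divKer_le_of_le_norm (hα : 0 ≤ α) (hε : 0 < ε) {v : E} (hy : ε ≤ ‖y‖) :
    ‖divKer α y v‖ ≤ ‖v‖ * ε ^ (-α - finrank ℝ E) := by
  refine (norm_divKer_le y v).trans ?_
  have := Real.rpow_le_rpow_of_nonpos (z := -α - finrank ℝ E) hε hy
    (by linarith [(finrank ℝ E).cast_nonneg (α := ℝ)])
  gcongr

variable [FiniteDimensional ℝ E] [MeasurableSpace E] [BorelSpace E]

theorem integrableOn_mul_divKer_const (hα : 0 ≤ α) (hε : 0 < ε) {g : E → ℝ} (hg : Integrable g)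
    (v : E) : IntegrableOn (fun y => g y * divKer α y v) {y | ε < ‖y‖} := by
  refine Integrable.mono' (hg.norm.mul_const (‖v‖ * ε ^ (-α - finrank ℝ E))).integrableOn
    (hg.aestronglyMeasurable.mul
      (measurable_divKer measurable_const).aestronglyMeasurable).restrict ?_
  filter_upwards [ae_restrict_mem (measurableSet_setOf_lt_norm ε)] with y hy
  rw [norm_mul]
  gcongr
  exact norm_divKer_le_of_le_norm hα hε (show ε < ‖y‖ from hy).le

theorem two_mul_setIntegral_sub_mul_divKer (hα : 0 ≤ α) (hε : 0 < ε) {f : E → ℝ}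
    (hf : Integrable f) (x v : E) :
    2 * ∫ y in {y | ε < ‖y‖}, f (x - y) * divKer α y v =
      ∫ y in {y | ε < ‖y‖}, (f (x - y) - f (x + y)) * divKer α y v := by
  have hodd := setIntegral_lt_norm_eq_zero_of_odd (ε := ε) volume
    (F := fun y => (f (x - y) + f (x + y)) * divKer α y v) fun y => by
      rw [divKer_neg_left, sub_neg_eq_add, ← sub_eq_add_neg]; ring
  have hsub := integrableOn_mul_divKer_const hα hε (hf.comp_sub_left x) v
  have hadd := integrableOn_mul_divKer_const hα hε (hf.comp_add_left x) v
  simp only [add_mul] at hodd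
  simp only [sub_mul]
  rw [integral_add hsub hadd] at hodd
  rw [integral_sub hsub hadd]
  linarith

end PowerAsymmetry

section ShellBump

variable {E : Type*} [NormedAddCommGroup E] [InnerProductSpace ℝ E] {δ : ℝ} {ψ : E → ℝ}

/-- Smooth cut-offs of the shell `δ ≤ |x| ≤ 1 / 16`, supported in the slightly larger shell
`δ / 2 ≤ |x| ≤ 1 / 8`. Radial fields cut off in this way test the variation of the witness. -/
structure IsShellBump (δ : ℝ) (ψ : E → ℝ) : Prop where
  smooth : ContDiff ℝ ∞ ψ
  nonneg : ∀ x, 0 ≤ ψ x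
  le_one : ∀ x, ψ x ≤ 1
  eq_zero_of_le : ∀ x, ‖x‖ ≤ δ / 2 → ψ x = 0
  eq_zero_of_ge : ∀ x, 1 / 8 ≤ ‖x‖ → ψ x = 0
  eq_one : ∀ x, δ ≤ ‖x‖ → ‖x‖ ≤ 1 / 16 → ψ x = 1

/-- The radial vector field `ψ(x) x / |x|`. -/
def radialField (ψ : E → ℝ) (x : E) : E := ψ x • ‖x‖⁻¹ • x

theorem exists_isShellBump (E : Type*) [NormedAddCommGroup E] [InnerProductSpace ℝ E]
    [FiniteDimensional ℝ E] {δ : ℝ} (hδ : 0 < δ) : ∃ ψ : E → ℝ, IsShellBump δ ψ := by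
  let inner : ContDiffBump (0 : E) := ⟨δ / 2, δ, half_pos hδ, half_lt_self hδ⟩
  let outer : ContDiffBump (0 : E) := ⟨1 / 16, 1 / 8, by norm_num, by norm_num⟩
  exact ⟨fun x => outer x * (1 - inner x),
    { smooth := outer.contDiff.mul (contDiff_const.sub inner.contDiff)
      nonneg := fun x => mul_nonneg outer.nonneg (sub_nonneg.2 inner.le_one)
      le_one := fun x => mul_le_one₀ outer.le_one (sub_nonneg.2 inner.le_one)
        (sub_le_self _ inner.nonneg)
      eq_zero_of_le := fun x hx => by
        rw [inner.one_of_mem_closedBall (mem_closedBall_zero_iff.2 hx), sub_self, mul_zero]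
      eq_zero_of_ge := fun x hx => by
        rw [outer.zero_of_le_dist (by rwa [dist_zero_right]), zero_mul]
      eq_one := fun x hδx hx => by
        rw [outer.one_of_mem_closedBall (mem_closedBall_zero_iff.2 hx),
          inner.zero_of_le_dist (by rwa [dist_zero_right]), sub_zero, one_mul] }⟩

namespace IsShellBump

theorem contDiff_radialField (hψ : IsShellBump δ ψ) (hδ : 0 < δ) :
    ContDiff ℝ ∞ (radialField ψ) := by
  rw [contDiff_iff_contDiffAt]
  intro x
  rcases eq_or_ne x 0 with rfl | hx
  · refine (contDiffAt_const (c := (0 : E))).congr_of_eventuallyEq ?_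
    filter_upwards [Metric.ball_mem_nhds (0 : E) (half_pos hδ)] with y hy
    rw [radialField, hψ.eq_zero_of_le y (mem_ball_zero_iff.1 hy).le, zero_smul]
  · exact hψ.smooth.contDiffAt.smul
      (((contDiffAt_norm ℝ hx).inv (norm_ne_zero_iff.2 hx)).smul contDiffAt_id)

theorem norm_radialField_le_one (hψ : IsShellBump δ ψ) (x : E) : ‖radialField ψ x‖ ≤ 1 := by
  rw [radialField, norm_smul, Real.norm_of_nonneg (hψ.nonneg x), norm_smul, norm_inv, norm_norm]
  exact mul_le_one₀ (hψ.le_one x) (by positivity) (inv_mul_le_one_of_le₀ le_rfl (norm_nonneg x))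

variable [FiniteDimensional ℝ E]

theorem hasCompactSupport (hψ : IsShellBump δ ψ) : HasCompactSupport ψ := by
  have := FiniteDimensional.proper ℝ E
  refine HasCompactSupport.intro (isCompact_closedBall (0 : E) (1 / 8)) fun x hx => ?_
  exact hψ.eq_zero_of_ge x (not_le.1 (mt mem_closedBall_zero_iff.2 hx)).le

variable [MeasurableSpace E] [BorelSpace E]

theorem integrable (hψ : IsShellBump δ ψ) : Integrable ψ :=
  hψ.smooth.continuous.integrable_of_hasCompactSupport hψ.hasCompactSupport

theorem integrable_mul_rpow (hψ : IsShellBump δ ψ) (hδ : 0 < δ) :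
    Integrable fun x => ψ x * ‖x‖ ^ (-(finrank ℝ E : ℝ)) := by
  refine (hψ.integrable.mul_const ((δ / 2) ^ (-(finrank ℝ E : ℝ)))).mono' ?_
    (Eventually.of_forall fun x => ?_)
  · have := hψ.smooth.continuous.measurable
    exact Measurable.aestronglyMeasurable (by fun_prop)
  · rw [Real.norm_of_nonneg (mul_nonneg (hψ.nonneg x) (by positivity))]
    by_cases hx : ‖x‖ ≤ δ / 2
    · simp only [hψ.eq_zero_of_le x hx, zero_mul, le_refl]
    · refine mul_le_mul_of_nonneg_left ?_ (hψ.nonneg x)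
      exact Real.rpow_le_rpow_of_nonpos (half_pos hδ) (not_le.1 hx).le (by simp)

theorem integral_le (hψ : IsShellBump δ ψ) :
    ∫ x, ψ x ≤ volume.real (Metric.ball (0 : E) (1 / 8)) := by
  rw [← integral_indicator_one measurableSet_ball]
  refine integral_mono hψ.integrable ((integrable_indicator_iff measurableSet_ball).2
    (integrableOn_const measure_ball_lt_top.ne)) fun x => ?_
  by_cases hx : ‖x‖ < 1 / 8
  · rw [Set.indicator_of_mem (mem_ball_zero_iff.2 hx)]; exact hψ.le_one x
  · rw [Set.indicator_of_notMem (mt mem_ball_zero_iff.1 hx), hψ.eq_zero_of_ge x (not_lt.1 hx)]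

end IsShellBump

theorem exists_isShellBump_lt_integral [FiniteDimensional ℝ E] [Nontrivial E] [MeasurableSpace E]
    [BorelSpace E] (A : ℝ) :
    ∃ δ > 0, ∃ ψ : E → ℝ, IsShellBump δ ψ ∧ A < ∫ x, ψ x * ‖x‖ ^ (-(finrank ℝ E : ℝ)) := by
  by_contra! hA
  set μ : Measure E := volume.restrict (Metric.ball 0 (1 / 16))
  have hfin : IsFiniteMeasure μ := ⟨by simpa [μ] using measure_ball_lt_top⟩
  have hcover : AECover μ atTop fun k : ℕ => {x : E | 1 / ((k : ℝ) + 1) < ‖x‖} := by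
    refine ⟨?_, fun k => measurableSet_setOf_lt_norm _⟩
    filter_upwards [ae_restrict_of_ae (Measure.ae_ne volume (0 : E))] with x hx
    exact tendsto_one_div_add_atTop_nhds_zero_nat.eventually_lt_const (norm_pos_iff.2 hx)
  have hint : Integrable (fun x : E => ‖x‖ ^ (-(finrank ℝ E : ℝ))) μ := by
    refine hcover.integrable_of_integral_norm_bounded A (fun k => ?_)
      (Eventually.of_forall fun k => ?_)
    · refine (integrable_const ((1 / ((k : ℝ) + 1)) ^ (-(finrank ℝ E : ℝ)))).mono'
        (Measurable.aestronglyMeasurable (by fun_prop)) ?_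
      filter_upwards [ae_restrict_mem (measurableSet_setOf_lt_norm _)] with x hx
      rw [Real.norm_of_nonneg (by positivity)]
      exact Real.rpow_le_rpow_of_nonpos (by positivity)
        (show 1 / ((k : ℝ) + 1) < ‖x‖ from hx).le (by simp)
    · obtain ⟨ψ, hψ⟩ := exists_isShellBump E (Nat.one_div_pos_of_nat (α := ℝ) (n := k))
      refine le_trans ?_ (hA _ Nat.one_div_pos_of_nat ψ hψ)
      rw [Measure.restrict_restrict (measurableSet_setOf_lt_norm _),
        ← integral_indicator ((measurableSet_setOf_lt_norm _).inter measurableSet_ball)]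
      refine integral_mono_of_nonneg (Eventually.of_forall fun x => ?_)
        (hψ.integrable_mul_rpow Nat.one_div_pos_of_nat) (Eventually.of_forall ?_)
      · exact Set.indicator_nonneg (fun _ _ => norm_nonneg _) x
      · refine Set.indicator_le' (fun x hx => ?_)
          fun x _ => mul_nonneg (hψ.nonneg x) (by positivity)
        rw [hψ.eq_one x (Set.mem_ofPred.1 hx.1).le (mem_ball_zero_iff.1 hx.2).le, one_mul,
          Real.norm_of_nonneg (by positivity)]
  have := (integrableOn_ball_norm_rpow_iff volume (by norm_num)).1 hint
  simp at this

end ShellBump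

section WitnessVariation

variable {n : ℕ} {α ε : ℝ} {η : ℝ → ℝ} {L : ℝ≥0}

theorem IsShellBump.isTestField {δ : ℝ} {ψ : EuclideanSpace ℝ (Fin n) → ℝ}
    (hψ : IsShellBump δ ψ) (hδ : 0 < δ) : IsTestField (radialField ψ) where
  smooth := hψ.contDiff_radialField hδ
  compactSupport := hψ.hasCompactSupport.smul_right
  norm_le_one := hψ.norm_radialField_le_one

theorem exists_le_witness_sub_mul_divKer (hα : α ∈ Set.Ico (0 : ℝ) n) (hη : IsRadialCutoff η L) :
    ∃ c : ℝ, 0 < c ∧ ∀ x y : EuclideanSpace ℝ (Fin n), ‖x‖ < 1 / 8 → y ≠ x → y ≠ -x →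
      (Metric.ball x (‖x‖ / 2)).indicator (fun _ => c * ‖x‖ ^ (-(2 * n : ℝ))) y -
          (1 / 4) ^ (-α - n) * (witness n α η (x - y) + witness n α η (x + y)) ≤
        (witness n α η (x - y) - witness n α η (x + y)) * divKer α y (‖x‖⁻¹ • x) := by
  obtain ⟨c, hc, hcα⟩ := exists_le_rpow_norm_sub_sub_mul_divKer (E := EuclideanSpace ℝ (Fin n))
    (α := α) (by rwa [finrank_euclideanSpace_fin])
  refine ⟨c, hc, fun x y hx hyx hyx' => ?_⟩
  have hsub := witness_nonneg (α := α) hη (x - y)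
  have hadd := witness_nonneg (α := α) hη (x + y)
  rcases lt_or_ge ‖y‖ (1 / 4) with hy | hy
  · suffices h : (Metric.ball x (‖x‖ / 2)).indicator (fun _ => c * ‖x‖ ^ (-(2 * n : ℝ))) y ≤
        (witness n α η (x - y) - witness n α η (x + y)) * divKer α y (‖x‖⁻¹ • x) from
      (sub_le_self _ (by positivity)).trans h
    rw [witness_eq_rpow hη (by linarith [norm_sub_le x y]),
      witness_eq_rpow hη (by linarith [norm_add_le x y])]
    by_cases hyb : y ∈ Metric.ball x (‖x‖ / 2)
    · rw [Set.indicator_of_mem hyb]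
      simpa only [finrank_euclideanSpace_fin] using hcα x y hyx (mem_ball_iff_norm.1 hyb)
    · rw [Set.indicator_of_notMem hyb]
      simpa only [finrank_euclideanSpace_fin] using
        rpow_norm_sub_sub_mul_divKer_nonneg (α := α) (by simpa using hα.2.le) hyx hyx'
  · have hyb : y ∉ Metric.ball x (‖x‖ / 2) := fun h => by
      linarith [norm_sub_norm_le y x, mem_ball_iff_norm.1 h]
    have hker : ‖divKer α y (‖x‖⁻¹ • x)‖ ≤ (1 / 4) ^ (-α - n) := by
      refine (norm_divKer_le_of_le_norm hα.1 (by norm_num) hy).trans ?_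
      rw [finrank_euclideanSpace_fin, norm_smul, norm_inv, norm_norm]
      exact mul_le_of_le_one_left (by positivity) (inv_mul_le_one_of_le₀ le_rfl (norm_nonneg x))
    have hdiff : |witness n α η (x - y) - witness n α η (x + y)| ≤
        witness n α η (x - y) + witness n α η (x + y) := by
      rw [abs_le]; constructor <;> linarith
    rw [Set.indicator_of_notMem hyb, zero_sub]
    refine neg_le_of_abs_le ?_
    rw [abs_mul, mul_comm]
    exact mul_le_mul hker hdiff (abs_nonneg _) (by positivity)

variable [NeZero n]

theorem setIntegral_indicator_ball_half_norm {x : EuclideanSpace ℝ (Fin n)} (hεx : ε < ‖x‖ / 2)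
    (hx : 0 < ‖x‖) (c : ℝ) :
    ∫ y in {y | ε < ‖y‖},
        (Metric.ball x (‖x‖ / 2)).indicator (fun _ => c * ‖x‖ ^ (-(2 * n : ℝ))) y =
      c * (1 / 2) ^ n * volume.real (Metric.ball (0 : EuclideanSpace ℝ (Fin n)) 1) *
        ‖x‖ ^ (-(n : ℝ)) := by
  have hsub : Metric.ball x (‖x‖ / 2) ⊆ {y | ε < ‖y‖} := fun y hy => by
    have := mem_ball_iff_norm'.1 hy
    exact Set.mem_ofPred.2 (by linarith [norm_sub_norm_le x y])
  rw [setIntegral_indicator measurableSet_ball, Set.inter_eq_right.2 hsub, setIntegral_const,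
    Measure.real, Measure.addHaar_ball _ _ (by positivity), ENNReal.toReal_mul,
    ENNReal.toReal_ofReal (by positivity), finrank_euclideanSpace_fin, smul_eq_mul,
    ← Measure.real,
    show -(n : ℝ) = n + -(2 * n) by ring, Real.rpow_add hx, Real.rpow_natCast, div_pow, div_pow,
    one_pow]
  ring

theorem exists_setIntegral_witness_mul_divKer_ge (hα : α ∈ Set.Ioo (0 : ℝ) n)
    (hη : IsRadialCutoff η L) :
    ∃ c C : ℝ, 0 < c ∧ 0 ≤ C ∧ ∀ x : EuclideanSpace ℝ (Fin n), ∀ ε, 0 < ε → ε < ‖x‖ / 2 →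
      ‖x‖ < 1 / 8 → c * ‖x‖ ^ (-(n : ℝ)) - C ≤
        ∫ y in {y | ε < ‖y‖}, witness n α η (x - y) * divKer α y (‖x‖⁻¹ • x) := by
  have hf := integrable_witness ⟨hα.1, hα.2.le⟩ hη
  obtain ⟨c, hc, hcα⟩ := exists_le_witness_sub_mul_divKer ⟨hα.1.le, hα.2⟩ hη
  set f := witness n α η
  set V := volume.real (Metric.ball (0 : EuclideanSpace ℝ (Fin n)) 1)
  have hV : 0 < V :=
    ENNReal.toReal_pos (Metric.measure_ball_pos _ _ one_pos).ne' measure_ball_lt_top.ne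
  set D : ℝ := (1 / 4) ^ (-α - n)
  have hI : 0 ≤ ∫ x, f x := integral_nonneg fun x => witness_nonneg hη x
  refine ⟨c * (1 / 2) ^ n * V / 2, D * ∫ x, f x, by positivity, by positivity, ?_⟩
  intro x ε hε hεx hx
  have hsum : Integrable fun y => f (x - y) + f (x + y) :=
    (hf.comp_sub_left x).add (hf.comp_add_left x)
  have hsum_le : ∫ y in {y | ε < ‖y‖}, (f (x - y) + f (x + y)) ≤ 2 * ∫ x, f x := by
    refine (setIntegral_le_integral hsum (Eventually.of_forall fun y =>
      add_nonneg (witness_nonneg hη _) (witness_nonneg hη _))).trans_eq ?_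
    rw [integral_add (hf.comp_sub_left x) (hf.comp_add_left x),
      integral_sub_left_eq_self f volume x, integral_add_left_eq_self f x, two_mul]
  have hbump : Integrable
      ((Metric.ball x (‖x‖ / 2)).indicator fun _ => c * ‖x‖ ^ (-(2 * n : ℝ))) :=
    (integrable_indicator_iff measurableSet_ball).2 (integrableOn_const measure_ball_lt_top.ne)
  have hmono := integral_mono_ae (μ := volume.restrict {y | ε < ‖y‖})
    (hbump.integrableOn.sub (hsum.const_mul D).integrableOn)
    (integrableOn_mul_divKer_const hα.1.le hε ((hf.comp_sub_left x).sub (hf.comp_add_left x))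
      (‖x‖⁻¹ • x)) (ae_restrict_of_ae (by
        filter_upwards [Measure.ae_ne volume x, Measure.ae_ne volume (-x)] with y using
          hcα x y hx))
  simp only [Pi.sub_apply] at hmono
  rw [integral_sub hbump.integrableOn (hsum.const_mul D).integrableOn,
    setIntegral_indicator_ball_half_norm hεx (by linarith), integral_const_mul,
    ← two_mul_setIntegral_sub_mul_divKer hα.1.le hε hf] at hmono
  have : D * ∫ y in {y | ε < ‖y‖}, (f (x - y) + f (x + y)) ≤ D * (2 * ∫ x, f x) := by gcongr
  linarith

theorem exists_integral_witness_mul_pvDiv_radialField_ge (hα : α ∈ Set.Ioo 0 1)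
    (hη : IsRadialCutoff η L) :
    ∃ c C : ℝ, 0 < c ∧ ∀ δ > 0, ∀ ψ : EuclideanSpace ℝ (Fin n) → ℝ, IsShellBump δ ψ →
      c * (∫ x, ψ x * ‖x‖ ^ (-(n : ℝ))) - C ≤
        ∫ x, witness n α η x * pvDiv α (radialField ψ) x := by
  have hn : (1 : ℝ) ≤ n := by exact_mod_cast NeZero.one_le
  obtain ⟨c, C, hc, hC, hcC⟩ :=
    exists_setIntegral_witness_mul_divKer_ge ⟨hα.1, hα.2.trans_le hn⟩ hη
  refine ⟨c, C * volume.real (Metric.ball (0 : EuclideanSpace ℝ (Fin n)) (1 / 8)), hc, ?_⟩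
  intro δ hδ ψ hψ
  obtain ⟨K, hK⟩ := (hψ.isTestField hδ).exists_isBddLip
  have hf := integrable_witness ⟨hα.1, (hα.2.trans_le hn).le⟩ hη
  have hmain : Integrable fun x => c * (ψ x * ‖x‖ ^ (-(n : ℝ))) := by
    simpa only [finrank_euclideanSpace_fin] using (hψ.integrable_mul_rpow hδ).const_mul c
  have hrest := hψ.integrable.const_mul C
  refine ge_of_tendsto (tendsto_integral_mul_truncDiv hα hK hf) ?_
  filter_upwards [Ioo_mem_nhdsGT (show 0 < δ / 4 by positivity)] with ε ⟨hε, hεδ⟩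
  calc c * (∫ x, ψ x * ‖x‖ ^ (-(n : ℝ))) -
        C * volume.real (Metric.ball (0 : EuclideanSpace ℝ (Fin n)) (1 / 8))
      ≤ c * (∫ x, ψ x * ‖x‖ ^ (-(n : ℝ))) - C * ∫ x, ψ x := by
        gcongr
        exact hψ.integral_le
    _ = ∫ x, (c * (ψ x * ‖x‖ ^ (-(n : ℝ))) - C * ψ x) := by
        rw [integral_sub hmain hrest, integral_const_mul, integral_const_mul]
    _ ≤ ∫ x, ∫ y in {y | ε < ‖y‖},
          witness n α η (x - y) * divKer α y (radialField ψ x) := by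
        refine integral_mono (hmain.sub hrest) (integrable_translate_mul_divKer_prod hα.1 hK hf
          (measurable_witness hη) hε).integral_prod_left fun x => ?_
        simp only [radialField, divKer_smul (ψ x), mul_left_comm _ (ψ x), integral_const_mul]
        by_cases hx : ‖x‖ ≤ δ / 2 ∨ 1 / 8 ≤ ‖x‖
        · simp [hx.elim (hψ.eq_zero_of_le x) (hψ.eq_zero_of_ge x)]
        · push Not at hx
          have := mul_le_mul_of_nonneg_left (hcC x ε hε (by linarith) hx.2) (hψ.nonneg x)
          linarith
    _ = ∫ x, witness n α η x * truncDiv α ε (radialField ψ) x :=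
        (integral_mul_truncDiv hα.1 hK hf (measurable_witness hη) hε).symm

theorem fracVariation_witness_eq_top (hα : α ∈ Set.Ioo 0 1) (hη : IsRadialCutoff η L) :
    fracVariation α (witness n α η) = ⊤ := by
  obtain ⟨c, C, hc, hcC⟩ := exists_integral_witness_mul_pvDiv_radialField_ge (n := n) hα hη
  have hμ : 0 < muConst n α := muConst_pos hα
  refine ENNReal.eq_top_of_forall_nnreal_le fun r => ?_
  obtain ⟨δ, hδ, ψ, hψ, hr⟩ := exists_isShellBump_lt_integral (E := EuclideanSpace ℝ (Fin n))
    ((r / muConst n α + C) / c)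
  rw [finrank_euclideanSpace_fin, div_lt_iff₀ hc] at hr
  obtain ⟨K, hK⟩ := (hψ.isTestField hδ).exists_isBddLip
  refine le_iSup₂_of_le (radialField ψ) (hψ.isTestField hδ) ?_
  have hdiv : ∫ x, witness n α η x * fracDiv α (radialField ψ) x =
      muConst n α * ∫ x, witness n α η x * pvDiv α (radialField ψ) x := by
    rw [← integral_const_mul]
    simp only [fracDiv_eq hα hK, mul_left_comm]
  rw [hdiv, ← ENNReal.ofReal_coe_nnreal]
  refine ENNReal.ofReal_le_ofReal ((div_le_iff₀' hμ).1 ?_)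
  linarith [hcC δ hδ ψ hψ]

theorem witness_notMem_BVSpace (hα : α ∈ Set.Ioo 0 1) (hη : IsRadialCutoff η L) :
    witness n α η ∉ BVSpace n α :=
  fun h => h.2.ne (fracVariation_witness_eq_top hα hη)

end WitnessVariation

/-! ### The heat kernel -/

section HeatKernel

variable {E : Type*} [NormedAddCommGroup E] [InnerProductSpace ℝ E] {t s : ℝ}

/-- The heat kernel at time `t / 4`. -/
def heatKer (t : ℝ) (y : E) : ℝ :=
  (Real.pi * t) ^ (-(finrank ℝ E : ℝ) / 2) * Real.exp (-(‖y‖ ^ 2 / t))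

/-- The time derivative of `heatKer`. -/
def heatKerDeriv (t : ℝ) (y : E) : ℝ :=
  heatKer t y * ((‖y‖ ^ 2 / t - finrank ℝ E / 2) / t)

theorem heatKer_nonneg (ht : 0 < t) (y : E) : 0 ≤ heatKer t y := by
  unfold heatKer; positivity

theorem heatKer_le (ht : 0 < t) (y : E) :
    heatKer t y ≤ (Real.pi * t) ^ (-(finrank ℝ E : ℝ) / 2) := by
  have hexp : Real.exp (-(‖y‖ ^ 2 / t)) ≤ 1 := Real.exp_le_one_iff.2 (neg_nonpos.2 (by positivity))
  exact mul_le_of_le_one_right (by positivity) hexp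

theorem hasDerivAt_heatKer (ht : 0 < t) (y : E) :
    HasDerivAt (fun t => heatKer t y) (heatKerDeriv t y) t := by
  have hpow := ((hasDerivAt_id t).const_mul Real.pi).rpow_const (p := -(finrank ℝ E : ℝ) / 2)
    (Or.inl (by positivity))
  have hexp := ((hasDerivAt_inv ht.ne').const_mul (-‖y‖ ^ 2)).exp
  convert! hpow.mul hexp using 1
  · ext t; simp only [heatKer, id, Pi.mul_apply]; congr 2; ring
  · have hπt : 0 < Real.pi * t := by positivity
    simp only [heatKerDeriv, heatKer, id, Real.rpow_sub_one hπt.ne']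
    rw [show -‖y‖ ^ 2 * t⁻¹ = -(‖y‖ ^ 2 / t) by ring]
    field_simp
    ring

theorem abs_heatKerDeriv_le (ht : 0 < t) (y : E) :
    |heatKerDeriv t y| ≤
      (Real.pi * t) ^ (-(finrank ℝ E : ℝ) / 2) * ((1 + finrank ℝ E / 2) / t) := by
  have hq : 0 ≤ ‖y‖ ^ 2 / t := by positivity
  set q := ‖y‖ ^ 2 / t with hqdef
  have hexp : Real.exp (-q) * |q - finrank ℝ E / 2| ≤ 1 + finrank ℝ E / 2 := by
    have hdist : |q - finrank ℝ E / 2| ≤ q + finrank ℝ E / 2 := by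
      rw [abs_le]
      constructor <;> linarith [(by positivity : (0 : ℝ) ≤ finrank ℝ E / 2)]
    rw [Real.exp_neg, inv_mul_le_iff₀ (Real.exp_pos q)]
    nlinarith [Real.add_one_le_exp q, (by positivity : (0 : ℝ) ≤ finrank ℝ E / 2)]
  rw [heatKerDeriv, heatKer, ← hqdef, mul_assoc, mul_div_assoc', abs_mul, abs_div, abs_mul,
    abs_of_pos ht, abs_of_pos (Real.exp_pos _), abs_of_nonneg (by positivity)]
  gcongr

theorem norm_mul_abs_heatKerDeriv_le (ht : 0 < t) (y : E) :
    ‖y‖ * |heatKerDeriv t y| ≤ (t ^ 2)⁻¹ * (‖y‖ ^ 3 * heatKer t y) +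
      finrank ℝ E / (2 * t) * (‖y‖ ^ 1 * heatKer t y) := by
  have hdist : |‖y‖ ^ 2 / t - finrank ℝ E / 2| ≤ ‖y‖ ^ 2 / t + finrank ℝ E / 2 :=
    (abs_sub _ _).trans_eq (by rw [abs_of_nonneg (by positivity), abs_of_nonneg (by positivity)])
  have hker := heatKer_nonneg ht y
  rw [heatKerDeriv, abs_mul, abs_div, abs_of_pos ht, abs_of_nonneg hker]
  calc ‖y‖ * (heatKer t y * (|‖y‖ ^ 2 / t - finrank ℝ E / 2| / t))
      ≤ ‖y‖ * (heatKer t y * ((‖y‖ ^ 2 / t + finrank ℝ E / 2) / t)) := by gcongr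
    _ = _ := by field_simp

/-- Completing the square: the product of the heat kernels centred at `0` and at `w` is a Gaussian
centred at `t / (t + s) • w`. -/
theorem heatKer_mul_heatKer_sub (ht : 0 < t) (hs : 0 < s) (v w : E) :
    heatKer t ((t / (t + s)) • w + v) * heatKer s (w - ((t / (t + s)) • w + v)) =
      heatKer (t + s) w * heatKer (t * s / (t + s)) v := by
  have : 0 < t + s := by positivity
  have hsub : w - ((t / (t + s)) • w + v) = (s / (t + s)) • w - v := by
    rw [show s / (t + s) = 1 - t / (t + s) by field_simp; ring]; module
  have hconst : (Real.pi * t) ^ (-(finrank ℝ E : ℝ) / 2) * (Real.pi * s) ^ (-(finrank ℝ E : ℝ) / 2)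
      = (Real.pi * (t + s)) ^ (-(finrank ℝ E : ℝ) / 2) *
        (Real.pi * (t * s / (t + s))) ^ (-(finrank ℝ E : ℝ) / 2) := by
    rw [← Real.mul_rpow (by positivity) (by positivity),
      ← Real.mul_rpow (by positivity) (by positivity)]
    congr 1; field_simp
  simp only [heatKer]
  rw [mul_mul_mul_comm, hconst, mul_mul_mul_comm (_ ^ _) (Real.exp _), ← Real.exp_add,
    ← Real.exp_add, hsub, norm_add_sq_real, norm_sub_sq_real, inner_smul_left, inner_smul_left,
    norm_smul, norm_smul, mul_pow, mul_pow, Real.norm_eq_abs, Real.norm_eq_abs, sq_abs, sq_abs]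
  congr 2
  simp only [conj_trivial]
  field_simp
  ring

theorem inner_heat_center_add_sub (ht : 0 < t) (hs : 0 < s) (v w : E) :
    inner ℝ ((t / (t + s)) • w + v) (w - ((t / (t + s)) • w + v)) =
      t * s / (t + s) ^ 2 * ‖w‖ ^ 2 - ‖v‖ ^ 2 + (s - t) / (t + s) * inner ℝ w v := by
  simp only [inner_sub_right, inner_add_left, inner_add_right, inner_smul_left, inner_smul_right,
    real_inner_self_eq_norm_sq, real_inner_comm w v, conj_trivial]
  have : 0 < t + s := by positivity
  field_simp
  ring

@[fun_prop]
theorem continuous_heatKer (t : ℝ) : Continuous (heatKer t : E → ℝ) := by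
  unfold heatKer; fun_prop

variable [MeasurableSpace E] [BorelSpace E] [FiniteDimensional ℝ E] [Nontrivial E]

theorem integrable_norm_pow_mul_heatKer (j : ℕ) (ht : 0 < t) :
    Integrable fun y : E => ‖y‖ ^ j * heatKer t y := by
  refine (integrable_fun_norm_addHaar volume (f := fun y : ℝ =>
    y ^ j * ((Real.pi * t) ^ (-(finrank ℝ E : ℝ) / 2) * Real.exp (-(y ^ 2 / t))))).2 ?_
  have h := (integrableOn_rpow_mul_exp_neg_mul_sq (inv_pos.2 ht)
    (s := ((finrank ℝ E - 1 + j : ℕ) : ℝ)) (neg_one_lt_zero.trans_le (Nat.cast_nonneg _))).const_mul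
    ((Real.pi * t) ^ (-(finrank ℝ E : ℝ) / 2))
  refine IntegrableOn.congr_fun h (fun y _ => ?_) measurableSet_Ioi
  simp only [smul_eq_mul, Real.rpow_natCast, pow_add]
  rw [show -t⁻¹ * y ^ 2 = -(y ^ 2 / t) by ring]
  ring

theorem integral_norm_pow_mul_heatKer (j : ℕ) (ht : 0 < t) :
    ∫ y : E, ‖y‖ ^ j * heatKer t y =
      Real.Gamma ((finrank ℝ E + j) / 2) / Real.Gamma (finrank ℝ E / 2) * t ^ (j / 2 : ℝ) := by
  have hd : (0 : ℝ) < finrank ℝ E := by exact_mod_cast Module.finrank_pos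
  have hradial : ∫ y in Set.Ioi (0 : ℝ), y ^ (finrank ℝ E - 1) •
        (y ^ j * ((Real.pi * t) ^ (-(finrank ℝ E : ℝ) / 2) * Real.exp (-(y ^ 2 / t)))) =
      (Real.pi * t) ^ (-(finrank ℝ E : ℝ) / 2) * (t⁻¹ ^ (-(finrank ℝ E + j : ℝ) / 2) * (1 / 2) *
        Real.Gamma ((finrank ℝ E + j) / 2)) := by
    rw [← sub_add_cancel (finrank ℝ E + j : ℝ) 1, ← integral_rpow_mul_exp_neg_mul_rpow two_pos
      (by linarith [Nat.cast_nonneg (α := ℝ) j]) (inv_pos.2 ht), ← integral_const_mul]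
    refine setIntegral_congr_fun measurableSet_Ioi fun y hy => ?_
    rw [← pow_finrank_pred_mul_rpow (E := E) hy, Real.rpow_two, Real.rpow_natCast]
    rw [show -t⁻¹ * y ^ 2 = -(y ^ 2 / t) by ring, smul_eq_mul]
    ring
  have hvol : volume.real (Metric.ball (0 : E) 1) =
      Real.pi ^ (finrank ℝ E / 2 : ℝ) / (finrank ℝ E / 2 * Real.Gamma (finrank ℝ E / 2)) := by
    rw [measureReal_def, InnerProductSpace.volume_ball, ENNReal.ofReal_one, one_pow, one_mul,
      ENNReal.toReal_ofReal (by positivity), Real.Gamma_add_one (by positivity),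
      Real.sqrt_eq_rpow, ← Real.rpow_mul_natCast Real.pi_pos.le, one_div_mul_eq_div]
  refine (integral_fun_norm_addHaar (volume : Measure E) (fun y : ℝ => y ^ j *
    ((Real.pi * t) ^ (-(finrank ℝ E : ℝ) / 2) * Real.exp (-(y ^ 2 / t))))).trans ?_
  have hscale : t⁻¹ ^ (-(finrank ℝ E + j : ℝ) / 2) =
      t ^ (finrank ℝ E / 2 : ℝ) * t ^ (j / 2 : ℝ) := by
    rw [Real.inv_rpow ht.le, ← Real.rpow_neg ht.le, ← Real.rpow_add ht]
    congr 1; ring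
  have := Real.Gamma_pos_of_pos (half_pos hd)
  rw [hradial, hvol, hscale, Real.mul_rpow Real.pi_pos.le ht.le, neg_div,
    Real.rpow_neg Real.pi_pos.le, Real.rpow_neg ht.le, nsmul_eq_mul, smul_eq_mul]
  field_simp

theorem integrable_heatKer (ht : 0 < t) : Integrable (heatKer t : E → ℝ) := by
  simpa only [pow_zero, one_mul] using integrable_norm_pow_mul_heatKer (E := E) 0 ht

theorem integral_heatKer (ht : 0 < t) : ∫ y : E, heatKer t y = 1 := by
  have hd : (0 : ℝ) < finrank ℝ E := by exact_mod_cast Module.finrank_pos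
  simpa [(Real.Gamma_pos_of_pos (half_pos hd)).ne'] using
    integral_norm_pow_mul_heatKer (E := E) 0 ht

theorem integral_norm_sq_mul_heatKer (ht : 0 < t) :
    ∫ y : E, ‖y‖ ^ 2 * heatKer t y = finrank ℝ E / 2 * t := by
  have hd : (0 : ℝ) < finrank ℝ E := by exact_mod_cast Module.finrank_pos
  have := Real.Gamma_pos_of_pos (half_pos hd)
  rw [integral_norm_pow_mul_heatKer 2 ht, Nat.cast_ofNat, add_div, div_self two_ne_zero,
    Real.Gamma_add_one (by positivity), Real.rpow_one]
  field_simp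

theorem integrable_norm_mul_heatKer (ht : 0 < t) : Integrable fun y : E => ‖y‖ * heatKer t y := by
  simpa only [pow_one] using integrable_norm_pow_mul_heatKer (E := E) 1 ht

theorem integrable_heatKerDeriv (ht : 0 < t) : Integrable (heatKerDeriv t : E → ℝ) := by
  refine (((integrable_norm_pow_mul_heatKer 2 ht).const_mul (t ^ 2)⁻¹).sub
    ((integrable_heatKer ht).const_mul (finrank ℝ E / (2 * t)))).congr
    (Eventually.of_forall fun y => ?_)
  simp only [heatKerDeriv, Pi.sub_apply]
  field_simp

theorem integral_heatKerDeriv (ht : 0 < t) : ∫ y : E, heatKerDeriv t y = 0 := by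
  have hsplit : (heatKerDeriv t : E → ℝ) = fun y =>
      (t ^ 2)⁻¹ * (‖y‖ ^ 2 * heatKer t y) - finrank ℝ E / (2 * t) * heatKer t y := by
    ext y; simp only [heatKerDeriv]; field_simp
  rw [hsplit, integral_sub ((integrable_norm_pow_mul_heatKer 2 ht).const_mul _)
    ((integrable_heatKer ht).const_mul _), integral_const_mul, integral_const_mul,
    integral_norm_sq_mul_heatKer ht, integral_heatKer ht]
  field_simp
  ring

theorem integrable_norm_mul_abs_heatKerDeriv (ht : 0 < t) :
    Integrable fun y : E => ‖y‖ * |heatKerDeriv t y| := by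
  refine (((integrable_norm_pow_mul_heatKer (E := E) 3 ht).const_mul (t ^ 2)⁻¹).add
    ((integrable_norm_pow_mul_heatKer 1 ht).const_mul (finrank ℝ E / (2 * t)))).mono'
    (measurable_norm.aestronglyMeasurable.mul (integrable_heatKerDeriv ht).abs.1)
    (Eventually.of_forall fun y => ?_)
  rw [Real.norm_of_nonneg (by positivity)]
  exact norm_mul_abs_heatKerDeriv_le ht y

variable (E) in
theorem exists_integral_norm_mul_abs_heatKerDeriv_le :
    ∃ C, ∀ t > 0, ∫ y : E, ‖y‖ * |heatKerDeriv t y| ≤ C * t ^ (-1 / 2 : ℝ) := by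
  refine ⟨(Real.Gamma ((finrank ℝ E + 3) / 2) +
    finrank ℝ E / 2 * Real.Gamma ((finrank ℝ E + 1) / 2)) / Real.Gamma (finrank ℝ E / 2),
    fun t ht => ?_⟩
  have h3 := (integrable_norm_pow_mul_heatKer (E := E) 3 ht).const_mul (t ^ 2)⁻¹
  have h1 := (integrable_norm_pow_mul_heatKer (E := E) 1 ht).const_mul (finrank ℝ E / (2 * t))
  refine (integral_mono (integrable_norm_mul_abs_heatKerDeriv ht) (h3.add h1)
    (norm_mul_abs_heatKerDeriv_le ht)).trans_eq ?_
  have ht3 : t ^ (3 / 2 : ℝ) = t ^ (-1 / 2 : ℝ) * t ^ 2 := by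
    rw [← Real.rpow_natCast, ← Real.rpow_add ht]; norm_num
  have ht1 : t ^ (1 / 2 : ℝ) = t ^ (-1 / 2 : ℝ) * t := by
    rw [← Real.rpow_add_one ht.ne']; norm_num
  rw [integral_add' h3 h1, integral_const_mul, integral_const_mul,
    integral_norm_pow_mul_heatKer 3 ht, integral_norm_pow_mul_heatKer 1 ht, Nat.cast_ofNat,
    Nat.cast_one, ht3, ht1]
  field_simp

/-- The divergence form of the semigroup law: `y ↦ y * heatKer t y` is `-t / 2` times the gradient
of the heat kernel, so the convolution is `t * s / 4` times the Laplacian of `heatKer (t + s)`. -/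
theorem integral_inner_sub_mul_heatKer_mul_heatKer (ht : 0 < t) (hs : 0 < s) (w : E) :
    ∫ y : E, inner ℝ y (w - y) * (heatKer t y * heatKer s (w - y)) =
      t * s * heatKerDeriv (t + s) w := by
  have : 0 < t + s := by positivity
  have hτ : 0 < t * s / (t + s) := by positivity
  rw [← integral_add_left_eq_self _ ((t / (t + s)) • w)]
  simp only [inner_heat_center_add_sub ht hs, heatKer_mul_heatKer_sub ht hs]
  set τ := t * s / (t + s) with hτdef
  have hsplit (v : E) : (t * s / (t + s) ^ 2 * ‖w‖ ^ 2 - ‖v‖ ^ 2 + (s - t) / (t + s) * inner ℝ w v)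
        * (heatKer (t + s) w * heatKer τ v) =
      heatKer (t + s) w * (t * s / (t + s) ^ 2 * ‖w‖ ^ 2 * heatKer τ v - ‖v‖ ^ 2 * heatKer τ v +
        (s - t) / (t + s) * (inner ℝ w v * heatKer τ v)) := by ring
  have hodd : ∫ v : E, inner ℝ w v * heatKer τ v = 0 :=
    integral_eq_zero_of_odd volume fun v => by simp [heatKer]
  have hinner : Integrable fun v : E => inner ℝ w v * heatKer τ v := by
    refine ((integrable_norm_mul_heatKer hτ).const_mul ‖w‖).mono'
      (by fun_prop) (Eventually.of_forall fun v => ?_)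
    rw [norm_mul, Real.norm_of_nonneg (heatKer_nonneg hτ v), ← mul_assoc]
    exact mul_le_mul_of_nonneg_right (norm_inner_le_norm w v) (heatKer_nonneg hτ v)
  have hheat := (integrable_heatKer (E := E) hτ).const_mul (t * s / (t + s) ^ 2 * ‖w‖ ^ 2)
  have hsq := integrable_norm_pow_mul_heatKer (E := E) 2 hτ
  have hdiff : Integrable fun v : E =>
      t * s / (t + s) ^ 2 * ‖w‖ ^ 2 * heatKer τ v - ‖v‖ ^ 2 * heatKer τ v := hheat.sub hsq
  simp only [hsplit]
  rw [integral_const_mul, integral_add hdiff (hinner.const_mul _),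
    integral_sub hheat hsq, integral_const_mul, integral_const_mul, hodd, integral_heatKer hτ,
    integral_norm_sq_mul_heatKer hτ, hτdef, heatKerDeriv]
  field_simp
  ring

end HeatKernel

section HeatMean

theorem integrableOn_Ioi_zero_of_abs_le_rpow {f : ℝ → ℝ} {a b p q : ℝ}
    (hf : AEStronglyMeasurable f (volume.restrict (Set.Ioi 0))) (hp : -1 < p) (hq : q < -1)
    (hfp : ∀ t > 0, |f t| ≤ a * t ^ p) (hfq : ∀ t > 0, |f t| ≤ b * t ^ q) :
    IntegrableOn f (Set.Ioi 0) := by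
  rw [← Set.Ioc_union_Ioi_eq_Ioi zero_le_one]
  refine IntegrableOn.union ?_ ?_
  · refine Integrable.mono' (((intervalIntegrable_iff_integrableOn_Ioc_of_le zero_le_one).1
      (intervalIntegral.intervalIntegrable_rpow' hp)).const_mul a)
      (hf.mono_set Set.Ioc_subset_Ioi_self) ?_
    exact (ae_restrict_iff' measurableSet_Ioc).2 (Eventually.of_forall fun t ht => hfp t ht.1)
  · refine Integrable.mono' ((integrableOn_Ioi_rpow_of_lt hq one_pos).const_mul b)
      (hf.mono_set (Set.Ioi_subset_Ioi zero_le_one)) ?_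
    exact (ae_restrict_iff' measurableSet_Ioi).2
      (Eventually.of_forall fun t ht => hfq t (one_pos.trans ht))

variable {E : Type*} [NormedAddCommGroup E] [InnerProductSpace ℝ E] [MeasurableSpace E]
  [BorelSpace E] {u : E → ℝ} {K : ℝ≥0} {t : ℝ}

@[fun_prop]
theorem measurable_heatKer_uncurry : Measurable fun z : ℝ × E => heatKer z.1 z.2 := by
  unfold heatKer; fun_prop

@[fun_prop]
theorem measurable_heatKerDeriv_uncurry : Measurable fun z : ℝ × E => heatKerDeriv z.1 z.2 := by
  unfold heatKerDeriv; fun_prop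

variable [FiniteDimensional ℝ E]

/-- The convolution of `u` with the heat kernel. -/
def heatMean (u : E → ℝ) (x : E) (t : ℝ) : ℝ :=
  ∫ w, heatKer t w * u (x - w)

/-- The time derivative of `heatMean`. -/
def heatMeanDeriv (u : E → ℝ) (x : E) (t : ℝ) : ℝ :=
  ∫ w, heatKerDeriv t w * u (x - w)

theorem measurable_heatMeanDeriv (hu : Measurable u) (x : E) :
    Measurable (heatMeanDeriv u x) := by
  have hmeas : Measurable fun z : ℝ × E => heatKerDeriv z.1 z.2 * u (x - z.2) := by fun_prop
  exact hmeas.stronglyMeasurable.integral_prod_right'.measurable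

theorem integrable_heatKer_mul (hu : Integrable u) (x : E) (ht : 0 < t) :
    Integrable fun w => heatKer t w * u (x - w) := by
  refine (hu.comp_sub_left x).bdd_mul (c := (Real.pi * t) ^ (-(finrank ℝ E : ℝ) / 2))
    (continuous_heatKer t).aestronglyMeasurable (Eventually.of_forall fun w => ?_)
  rw [Real.norm_of_nonneg (heatKer_nonneg ht w)]
  exact heatKer_le ht w

theorem integrable_heatKerDeriv_mul (hu : Integrable u) (x : E) (ht : 0 < t) :
    Integrable fun w => heatKerDeriv t w * u (x - w) := by
  exact (hu.comp_sub_left x).bdd_mul (Measurable.aestronglyMeasurable (by fun_prop))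
    (Eventually.of_forall (abs_heatKerDeriv_le ht))

theorem abs_heatMean_le (hu : Integrable u) (x : E) (ht : 0 < t) :
    |heatMean u x t| ≤ (Real.pi * t) ^ (-(finrank ℝ E : ℝ) / 2) * ∫ y, |u y| := by
  rw [← integral_sub_left_eq_self (fun y => |u y|) volume x, ← integral_const_mul,
    ← Real.norm_eq_abs]
  refine norm_integral_le_of_norm_le ((hu.comp_sub_left x).abs.const_mul _)
    (Eventually.of_forall fun w => ?_)
  rw [norm_mul, Real.norm_of_nonneg (heatKer_nonneg ht w), Real.norm_eq_abs]
  gcongr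
  exact heatKer_le ht w

theorem abs_heatMeanDeriv_le (hu : Integrable u) (x : E) (ht : 0 < t) :
    |heatMeanDeriv u x t| ≤ (Real.pi * t) ^ (-(finrank ℝ E : ℝ) / 2) *
      ((1 + finrank ℝ E / 2) / t) * ∫ y, |u y| := by
  rw [← integral_sub_left_eq_self (fun y => |u y|) volume x, ← integral_const_mul,
    ← Real.norm_eq_abs]
  refine norm_integral_le_of_norm_le ((hu.comp_sub_left x).abs.const_mul _)
    (Eventually.of_forall fun w => ?_)
  rw [norm_mul, Real.norm_eq_abs, Real.norm_eq_abs]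
  gcongr
  exact abs_heatKerDeriv_le ht w

theorem hasDerivAt_heatMean (hu : Integrable u) (hum : Measurable u) (x : E) (ht : 0 < t) :
    HasDerivAt (heatMean u x) (heatMeanDeriv u x t) t := by
  refine (hasDerivAt_integral_of_dominated_loc_of_deriv_le
    (F' := fun t w => heatKerDeriv t w * u (x - w))
    (bound := fun w => (Real.pi * (t / 2)) ^ (-(finrank ℝ E : ℝ) / 2) *
      ((1 + finrank ℝ E / 2) / (t / 2)) * |u (x - w)|)
    (Ioi_mem_nhds (half_lt_self ht))
    (Eventually.of_forall fun t => Measurable.aestronglyMeasurable (by fun_prop))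
    (integrable_heatKer_mul hu x ht)
    (Measurable.aestronglyMeasurable (by fun_prop))
    (Eventually.of_forall fun w s hs => ?_) ((hu.comp_sub_left x).abs.const_mul _)
    (Eventually.of_forall fun w s hs => ?_)).2
  · have hs0 : 0 < s := (half_pos ht).trans hs
    rw [norm_mul, Real.norm_eq_abs, Real.norm_eq_abs]
    refine mul_le_mul_of_nonneg_right ((abs_heatKerDeriv_le hs0 w).trans ?_) (abs_nonneg _)
    have hle : t / 2 ≤ s := (Set.mem_Ioi.1 hs).le
    refine mul_le_mul (Real.rpow_le_rpow_of_nonpos (by positivity) (by gcongr) ?_) (by gcongr)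
      (by positivity) (by positivity)
    exact div_nonpos_of_nonpos_of_nonneg (neg_nonpos.2 (Nat.cast_nonneg _)) zero_le_two
  · exact (hasDerivAt_heatKer ((half_pos ht).trans hs) w).mul_const _

theorem tendsto_heatMean_atTop [Nontrivial E] (hu : Integrable u) (x : E) :
    Tendsto (heatMean u x) atTop (𝓝 0) := by
  have hd : (0 : ℝ) < finrank ℝ E := by exact_mod_cast Module.finrank_pos
  have hpow : Tendsto (fun t : ℝ => (Real.pi * t) ^ (-(finrank ℝ E : ℝ) / 2) * ∫ y, |u y|) atTop
      (𝓝 (0 * ∫ y, |u y|)) := by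
    simp only [neg_div]
    exact ((tendsto_rpow_neg_atTop (half_pos hd)).comp
      (tendsto_id.const_mul_atTop Real.pi_pos)).mul_const _
  rw [zero_mul] at hpow
  refine squeeze_zero_norm' ?_ hpow
  filter_upwards [eventually_gt_atTop 0] with t ht using abs_heatMean_le hu x ht

theorem abs_integral_mul_sub_le {k : E → ℝ} (hk : Integrable fun w => ‖w‖ * |k w|)
    (hK : LipschitzWith K u) (x : E) :
    |∫ w, k w * (u (x - w) - u x)| ≤ K * ∫ w, ‖w‖ * |k w| := by
  rw [← integral_const_mul, ← Real.norm_eq_abs]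
  refine norm_integral_le_of_norm_le (hk.const_mul _) (Eventually.of_forall fun w => ?_)
  have hlip : ‖u (x - w) - u x‖ ≤ K * ‖w‖ := by simpa using hK.norm_sub_le (x - w) x
  rw [norm_mul, Real.norm_eq_abs, mul_comm, ← mul_assoc]
  gcongr

variable [Nontrivial E]

theorem tendsto_heatMean_zero (hu : Integrable u) (hK : LipschitzWith K u) (x : E) :
    Tendsto (heatMean u x) (𝓝[>] 0) (𝓝 (u x)) := by
  have habs {t : ℝ} (ht : 0 < t) (w : E) : ‖w‖ * |heatKer t w| = ‖w‖ ^ 1 * heatKer t w := by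
    rw [abs_of_nonneg (heatKer_nonneg ht w), pow_one]
  have hbound (t : ℝ) (ht : 0 < t) :
      |heatMean u x t - u x| ≤ K * ∫ w : E, ‖w‖ ^ 1 * heatKer t w := by
    have hsub : heatMean u x t - u x = ∫ w, heatKer t w * (u (x - w) - u x) := by
      simp only [mul_sub]
      rw [integral_sub (integrable_heatKer_mul hu x ht) ((integrable_heatKer ht).mul_const _),
        integral_mul_const, integral_heatKer ht, one_mul, heatMean]
    have hint : Integrable fun w : E => ‖w‖ * |heatKer t w| := by
      simpa only [habs ht] using integrable_norm_pow_mul_heatKer (E := E) 1 ht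
    simpa only [hsub, habs ht] using abs_integral_mul_sub_le hint hK x
  have hmoment : Tendsto (fun t => K * ∫ w : E, ‖w‖ ^ 1 * heatKer t w) (𝓝[>] 0) (𝓝 0) := by
    have hcont : Continuous fun t : ℝ => K * (Real.Gamma ((finrank ℝ E + (1 : ℕ)) / 2) /
        Real.Gamma (finrank ℝ E / 2) * t ^ ((1 : ℕ) / 2 : ℝ)) := by fun_prop (disch := simp)
    have hlim := (hcont.tendsto 0).mono_left (nhdsWithin_le_nhds (s := Set.Ioi 0))
    rw [Real.zero_rpow (by norm_num), mul_zero, mul_zero] at hlim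
    refine hlim.congr' ?_
    filter_upwards [self_mem_nhdsWithin] with t ht
    rw [integral_norm_pow_mul_heatKer 1 ht]
  refine tendsto_iff_norm_sub_tendsto_zero.2 (squeeze_zero' (Eventually.of_forall fun t =>
    norm_nonneg _) ?_ hmoment)
  filter_upwards [self_mem_nhdsWithin] with t ht using hbound t ht

theorem exists_abs_heatMeanDeriv_le (hu : Integrable u) (hK : LipschitzWith K u) (x : E) :
    ∃ C, ∀ t > 0, |heatMeanDeriv u x t| ≤ C * t ^ (-1 / 2 : ℝ) := by
  obtain ⟨C, hC⟩ := exists_integral_norm_mul_abs_heatKerDeriv_le E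
  refine ⟨K * C, fun t ht => ?_⟩
  have hsub : heatMeanDeriv u x t = ∫ w, heatKerDeriv t w * (u (x - w) - u x) := by
    simp only [mul_sub]
    rw [integral_sub (integrable_heatKerDeriv_mul hu x ht)
      ((integrable_heatKerDeriv ht).mul_const _), integral_mul_const, integral_heatKerDeriv ht,
      zero_mul, sub_zero, heatMeanDeriv]
  rw [hsub, mul_assoc]
  exact (abs_integral_mul_sub_le (integrable_norm_mul_abs_heatKerDeriv ht) hK x).trans
    (mul_le_mul_of_nonneg_left (hC t ht) K.coe_nonneg)

theorem integrableOn_heatMeanDeriv (hu : Integrable u) (hK : LipschitzWith K u) (x : E) :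
    IntegrableOn (heatMeanDeriv u x) (Set.Ioi 0) := by
  have hd : (0 : ℝ) < finrank ℝ E := by exact_mod_cast Module.finrank_pos
  obtain ⟨C, hC⟩ := exists_abs_heatMeanDeriv_le hu hK x
  refine integrableOn_Ioi_zero_of_abs_le_rpow (q := -(finrank ℝ E : ℝ) / 2 - 1)
    (b := Real.pi ^ (-(finrank ℝ E : ℝ) / 2) * (1 + finrank ℝ E / 2) * ∫ y, |u y|)
    (measurable_heatMeanDeriv hK.continuous.measurable x).aestronglyMeasurable (by norm_num)
    (by linarith) hC fun t ht => (abs_heatMeanDeriv_le hu x ht).trans_eq ?_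
  rw [Real.mul_rpow Real.pi_pos.le ht.le, Real.rpow_sub_one ht.ne']
  ring

theorem setIntegral_Ioi_heatMeanDeriv (hu : Integrable u) (hK : LipschitzWith K u) (x : E) :
    ∫ t in Set.Ioi 0, heatMeanDeriv u x t = -u x := by
  have hcongr : ∀ t ∈ Set.Ioi (0 : ℝ), Function.update (heatMean u x) 0 (u x) t = heatMean u x t :=
    fun t ht => Function.update_of_ne (Set.mem_Ioi.1 ht).ne' _ _
  have hderiv (t : ℝ) (ht : t ∈ Set.Ioi 0) :
      HasDerivAt (Function.update (heatMean u x) 0 (u x)) (heatMeanDeriv u x t) t :=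
    (hasDerivAt_heatMean hu hK.continuous.measurable x ht).congr_of_eventuallyEq
      (eventually_of_mem (Ioi_mem_nhds ht) hcongr)
  rw [integral_Ioi_of_hasDerivAt_of_tendsto ?_ hderiv (integrableOn_heatMeanDeriv hu hK x)
    ((tendsto_heatMean_atTop hu x).congr' (eventually_of_mem (Ioi_mem_atTop 0)
      fun t ht => (hcongr t ht).symm)), Function.update_self, zero_sub]
  rw [continuousWithinAt_update_same, Set.Ici_sdiff_left]
  exact tendsto_heatMean_zero hu hK x

end HeatMean

/-! ### Subordination to the heat kernel -/

section Subordination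

theorem setIntegral_Ioi_rpow_mul_exp_neg_div {a b : ℝ} (ha : 0 < a) (hb : 0 < b) :
    ∫ t in Set.Ioi (0 : ℝ), t ^ (-a - 1) * Real.exp (-(b / t)) = Real.Gamma a * b ^ (-a) := by
  have hinv := integral_comp_rpow_Ioi (fun t => t ^ (a - 1) * Real.exp (-(b * t)))
    (neg_ne_zero.2 one_ne_zero)
  rw [Real.integral_rpow_mul_exp_neg_mul_Ioi ha hb, one_div, Real.inv_rpow hb.le,
    ← Real.rpow_neg hb.le] at hinv
  rw [mul_comm, ← hinv]
  refine setIntegral_congr_fun measurableSet_Ioi fun t (ht : 0 < t) => ?_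
  rw [abs_neg, abs_one, one_mul, smul_eq_mul, ← Real.rpow_mul ht.le, ← mul_assoc,
    ← Real.rpow_add ht, Real.rpow_neg_one, div_eq_mul_inv]
  ring_nf

theorem integrableOn_Ioi_rpow_div_one_add {p : ℝ} (hp : p ∈ Set.Ioo (0 : ℝ) 1) :
    IntegrableOn (fun v : ℝ => v ^ (p - 1) / (1 + v)) (Set.Ioi 0) := by
  refine integrableOn_Ioi_zero_of_abs_le_rpow (a := 1) (b := 1) (p := p - 1) (q := p - 1 - 1)
    (Measurable.aestronglyMeasurable (by fun_prop)) (by linarith [hp.1]) (by linarith [hp.2])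
    (fun v hv => ?_) (fun v hv => ?_) <;> rw [abs_of_nonneg (by positivity), one_mul]
  · exact div_le_self (by positivity) (by linarith)
  · rw [Real.rpow_sub_one hv.ne' (p - 1)]
    exact div_le_div_of_nonneg_left (by positivity) hv (by linarith)

theorem setIntegral_Ioi_rpow_div_one_add_pos {p : ℝ} (hp : p ∈ Set.Ioo (0 : ℝ) 1) :
    0 < ∫ v in Set.Ioi (0 : ℝ), v ^ (p - 1) / (1 + v) := by
  have hpos (v : ℝ) (hv : 0 < v) : 0 < v ^ (p - 1) / (1 + v) := by positivity
  refine (setIntegral_pos_iff_support_of_nonneg_ae ?_ (integrableOn_Ioi_rpow_div_one_add hp)).2 ?_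
  · exact (ae_restrict_iff' measurableSet_Ioi).2 (Eventually.of_forall fun v hv => (hpos v hv).le)
  · have hsupp : Set.Ioi 0 ⊆ Function.support fun v : ℝ => v ^ (p - 1) / (1 + v) :=
      fun v hv => (hpos v hv).ne'
    rw [Set.inter_eq_right.2 hsupp]
    simp

theorem integrable_rpow_mul_comp_one_add_mul {p : ℝ} (hp : p ∈ Set.Ioo (0 : ℝ) 1) {h : ℝ → ℝ}
    (hh : Measurable h) (hint : IntegrableOn h (Set.Ioi 0)) :
    Integrable (fun z : ℝ × ℝ => z.2 ^ (p - 1) * h ((1 + z.2) * z.1))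
      ((volume.restrict (Set.Ioi 0)).prod (volume.restrict (Set.Ioi 0))) := by
  refine (integrable_prod_iff' (Measurable.aestronglyMeasurable (by fun_prop))).2 ⟨?_, ?_⟩
  · refine (ae_restrict_iff' measurableSet_Ioi).2 (Eventually.of_forall fun v (hv : 0 < v) => ?_)
    have hscale : IntegrableOn (fun t => h ((1 + v) * t)) (Set.Ioi 0) :=
      (integrableOn_Ioi_comp_mul_left_iff h 0 (by positivity)).2 (by rwa [mul_zero])
    exact hscale.const_mul (v ^ (p - 1))
  · refine IntegrableOn.congr_fun ((integrableOn_Ioi_rpow_div_one_add hp).mul_const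
      (∫ t in Set.Ioi 0, ‖h t‖)) (fun v (hv : 0 < v) => ?_) measurableSet_Ioi
    have hscale := integral_comp_mul_left_Ioi (fun t => ‖h t‖) 0 (by positivity : 0 < 1 + v)
    simp only [norm_mul, integral_const_mul]
    rw [hscale, mul_zero, smul_eq_mul, Real.norm_of_nonneg (by positivity)]
    ring

theorem setIntegral_Ioi_rpow_mul_setIntegral_Ioi_rpow_mul_comp_add {p : ℝ}
    (hp : p ∈ Set.Ioo (0 : ℝ) 1) {h : ℝ → ℝ} (hh : Measurable h)
    (hint : IntegrableOn h (Set.Ioi 0)) :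
    ∫ t in Set.Ioi (0 : ℝ), t ^ (-p) * ∫ s in Set.Ioi (0 : ℝ), s ^ (p - 1) * h (t + s) =
      (∫ v in Set.Ioi (0 : ℝ), v ^ (p - 1) / (1 + v)) * ∫ t in Set.Ioi (0 : ℝ), h t := by
  have hscale (t : ℝ) (ht : 0 < t) : t ^ (-p) * ∫ s in Set.Ioi (0 : ℝ), s ^ (p - 1) * h (t + s) =
      ∫ v in Set.Ioi (0 : ℝ), v ^ (p - 1) * h ((1 + v) * t) := by
    have hsub := integral_comp_mul_left_Ioi' (fun s => s ^ (p - 1) * h (t + s)) 0 ht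
    rw [mul_zero] at hsub
    rw [← hsub, smul_eq_mul, ← mul_assoc, ← Real.rpow_add_one ht.ne', ← integral_const_mul]
    refine setIntegral_congr_fun measurableSet_Ioi fun v (hv : 0 < v) => ?_
    rw [Real.mul_rpow ht.le hv.le, mul_assoc, ← mul_assoc, ← Real.rpow_add ht]
    ring_nf
    simp
  rw [setIntegral_congr_fun measurableSet_Ioi hscale,
    integral_integral_swap (integrable_rpow_mul_comp_one_add_mul hp hh hint), ← integral_mul_const]
  refine setIntegral_congr_fun measurableSet_Ioi fun v (hv : 0 < v) => ?_
  rw [integral_const_mul, integral_comp_mul_left_Ioi h 0 (by positivity : 0 < 1 + v), mul_zero,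
    smul_eq_mul]
  ring

variable (E : Type*) [NormedAddCommGroup E] [InnerProductSpace ℝ E]

/-- The constant in the Mellin transform of the heat kernel. -/
def heatMellin (β : ℝ) : ℝ :=
  Real.pi ^ (-(finrank ℝ E : ℝ) / 2) * Real.Gamma (β + finrank ℝ E / 2)

variable {E} {β : ℝ}

theorem heatMellin_pos (hβ : 0 < β) : 0 < heatMellin E β :=
  mul_pos (by positivity) (Real.Gamma_pos_of_pos (by positivity))

theorem setIntegral_Ioi_rpow_mul_heatKer (hβ : 0 < β) {y : E} (hy : y ≠ 0) :
    ∫ t in Set.Ioi (0 : ℝ), t ^ (-β - 1) * heatKer t y =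
      heatMellin E β * ‖y‖ ^ (-2 * β - finrank ℝ E) := by
  have hy0 : 0 < ‖y‖ := norm_pos_iff.2 hy
  have hpow : (‖y‖ ^ 2) ^ (-(β + finrank ℝ E / 2)) = ‖y‖ ^ (-2 * β - finrank ℝ E) := by
    rw [← Real.rpow_natCast, ← Real.rpow_mul hy0.le]
    push_cast; ring_nf
  rw [heatMellin, mul_assoc, ← hpow,
    ← setIntegral_Ioi_rpow_mul_exp_neg_div (by positivity) (by positivity), ← integral_const_mul]
  refine setIntegral_congr_fun measurableSet_Ioi fun t (ht : 0 < t) => ?_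
  have hmul : t ^ (-β - 1) * t ^ (-(finrank ℝ E : ℝ) / 2) =
      t ^ (-(β + finrank ℝ E / 2) - 1) := by
    rw [← Real.rpow_add ht]; ring_nf
  simp only [heatKer, Real.mul_rpow Real.pi_pos.le ht.le, ← hmul]
  ring

variable [MeasurableSpace E] [BorelSpace E] [FiniteDimensional ℝ E] [Nontrivial E] {a : E → ℝ}

theorem integrable_rpow_mul_mul_heatKer (hβ : 0 < β) (ha : Measurable a)
    (hint : Integrable fun y => a y * ‖y‖ ^ (-2 * β - finrank ℝ E)) :
    Integrable (fun z : ℝ × E => z.1 ^ (-β - 1) * (a z.2 * heatKer z.1 z.2))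
      ((volume.restrict (Set.Ioi 0)).prod volume) := by
  have hmellin {y : E} (hy : y ≠ 0) := setIntegral_Ioi_rpow_mul_heatKer hβ hy
  refine (integrable_prod_iff' (Measurable.aestronglyMeasurable (by fun_prop))).2 ⟨?_, ?_⟩
  · filter_upwards [compl_mem_ae_iff.2 (measure_singleton (0 : E))] with y hy
    have hpos : 0 < heatMellin E β * ‖y‖ ^ (-2 * β - finrank ℝ E) :=
      mul_pos (heatMellin_pos hβ) (Real.rpow_pos_of_pos (norm_pos_iff.2 hy) _)
    have hker : Integrable (fun t => t ^ (-β - 1) * heatKer t y) (volume.restrict (Set.Ioi 0)) :=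
      not_imp_comm.1 integral_undef (hmellin hy ▸ hpos.ne')
    simpa only [mul_left_comm] using hker.const_mul (a y)
  · refine (hint.norm.const_mul (heatMellin E β)).congr ?_
    filter_upwards [compl_mem_ae_iff.2 (measure_singleton (0 : E))] with y hy
    rw [norm_mul, Real.norm_of_nonneg (by positivity : 0 ≤ ‖y‖ ^ (-2 * β - finrank ℝ E)),
      mul_left_comm, ← hmellin hy, ← integral_const_mul]
    refine setIntegral_congr_fun measurableSet_Ioi fun t (ht : 0 < t) => ?_
    rw [norm_mul, norm_mul, Real.norm_of_nonneg (heatKer_nonneg ht y),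
      Real.norm_of_nonneg (Real.rpow_nonneg ht.le _)]
    ring

theorem heatMellin_mul_integral_mul_rpow (hβ : 0 < β) (ha : Measurable a)
    (hint : Integrable fun y => a y * ‖y‖ ^ (-2 * β - finrank ℝ E)) :
    heatMellin E β * ∫ y, a y * ‖y‖ ^ (-2 * β - finrank ℝ E) =
      ∫ t in Set.Ioi (0 : ℝ), t ^ (-β - 1) * ∫ y, a y * heatKer t y := by
  simp only [← integral_const_mul]
  rw [integral_integral_swap (integrable_rpow_mul_mul_heatKer hβ ha hint)]
  refine integral_congr_ae ?_
  filter_upwards [compl_mem_ae_iff.2 (measure_singleton (0 : E))] with y hy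
  simp only [mul_left_comm _ (a y)]
  rw [integral_const_mul, setIntegral_Ioi_rpow_mul_heatKer hβ hy]

end Subordination

/-! ### Inverting the fractional divergence -/

section Inversion

theorem integral_integral_eq_integral_integral_sub {G : Type*} [AddCommGroup G]
    [MeasurableSpace G] [MeasurableAdd₂ G] [MeasurableNeg G] {μ : Measure G} [SFinite μ]
    [μ.IsAddLeftInvariant] {F : G × G → ℝ} (hF : Integrable F (μ.prod μ)) :
    ∫ z, ∫ y, F (y, z) ∂μ ∂μ = ∫ w, ∫ y, F (y, w - y) ∂μ ∂μ := by
  have hshear : Integrable (fun p : G × G => F (p.1, p.2 - p.1)) (μ.prod μ) := by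
    simpa only [Function.comp_def, neg_add_eq_sub] using
      (measurePreserving_prod_neg_add μ μ).integrable_comp_of_integrable hF
  rw [← integral_integral_swap (f := fun y z => F (y, z)) hF,
    ← integral_integral_swap (f := fun y w => F (y, w - y)) hshear]
  congr! 2 with y
  exact (integral_sub_right_eq_self (fun z => F (y, z)) y).symm

variable {E : Type*} [NormedAddCommGroup E] [InnerProductSpace ℝ E] [FiniteDimensional ℝ E]
  [Nontrivial E] {α t s S M : ℝ} {K : ℝ≥0} {φ : E → E} {u : E → ℝ}

/-- An integrable majorant of `z ↦ v z * ‖z‖ ^ (α - d)` for `v` bounded by `S`: the bound is used in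
the unit ball, integrability of `v` outside of it. -/
def rieszMajorant (α S : ℝ) (v : E → ℝ) (z : E) : ℝ :=
  (Metric.ball 0 1).indicator (fun z : E => S * ‖z‖ ^ (α - finrank ℝ E)) z + |v z|

theorem abs_mul_norm_rpow_le_rieszMajorant (hα : α < 1) {v : E → ℝ} (hS : ∀ z, |v z| ≤ S) (z : E) :
    |v z| * ‖z‖ ^ (α - finrank ℝ E) ≤ rieszMajorant α S v z := by
  have hd : (1 : ℝ) ≤ finrank ℝ E := by exact_mod_cast Module.finrank_pos (R := ℝ) (M := E)
  by_cases hz : z ∈ Metric.ball (0 : E) 1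
  · rw [rieszMajorant, Set.indicator_of_mem hz]
    exact le_add_of_le_of_nonneg (by gcongr; exact hS z) (abs_nonneg _)
  · rw [rieszMajorant, Set.indicator_of_notMem hz, zero_add]
    exact mul_le_of_le_one_right (abs_nonneg _)
      (Real.rpow_le_one_of_one_le_of_nonpos (by simpa using hz) (by linarith))

variable [MeasurableSpace E] [BorelSpace E]

theorem integrable_inner_mul_heatKer (ht : 0 < t) (hφ : Measurable φ) (hM : ∀ x, ‖φ x‖ ≤ M) :
    Integrable fun y => inner ℝ y (φ y) * heatKer t y := by
  refine ((integrable_norm_mul_heatKer ht).const_mul M).mono'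
    (Measurable.aestronglyMeasurable (by fun_prop)) (Eventually.of_forall fun y => ?_)
  rw [norm_mul, Real.norm_of_nonneg (heatKer_nonneg ht y), ← mul_assoc, mul_comm M]
  refine mul_le_mul_of_nonneg_right ((norm_inner_le_norm _ _).trans ?_) (heatKer_nonneg ht y)
  gcongr
  exact hM y

theorem heatMellin_mul_pvDiv (hα : α ∈ Set.Ioo 0 1) (hφ : IsBddLip φ M K) (x : E) :
    heatMellin E ((1 + α) / 2) * pvDiv α φ x =
      -∫ t in Set.Ioi (0 : ℝ), t ^ (-((1 + α) / 2) - 1) *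
        ∫ y, inner ℝ y (φ (x - y)) * heatKer t y := by
  have hcont := hφ.lipschitz.continuous
  have hker (y : E) : divKer α y (φ (x + y) - φ x) =
      inner ℝ y (φ (x + y) - φ x) * ‖y‖ ^ (-2 * ((1 + α) / 2) - finrank ℝ E) := by
    rw [divKer, div_eq_mul_inv, ← Real.rpow_neg (norm_nonneg y)]
    ring_nf
  have hheat (t : ℝ) (ht : 0 < t) : ∫ y, inner ℝ y (φ (x + y) - φ x) * heatKer t y =
      -∫ y, inner ℝ y (φ (x - y)) * heatKer t y := by
    have hodd : ∫ y, inner ℝ y (φ x) * heatKer t y = 0 :=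
      integral_eq_zero_of_odd volume fun y => by simp [heatKer]
    simp only [inner_sub_right, sub_mul]
    rw [integral_sub (integrable_inner_mul_heatKer ht (by fun_prop) fun y => hφ.norm_le (x + y))
      (integrable_inner_mul_heatKer ht measurable_const fun _ => hφ.norm_le x), hodd, sub_zero,
      ← integral_neg_eq_self, ← integral_neg]
    simp [heatKer, sub_eq_add_neg]
  have hint := integrable_divKer_sub hα hφ x
  simp only [pvDiv, hker] at hint ⊢
  rw [heatMellin_mul_integral_mul_rpow (by linarith [hα.1]) (by fun_prop) hint, ← integral_neg]
  refine setIntegral_congr_fun measurableSet_Ioi fun t ht => ?_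
  rw [hheat t ht, mul_neg]

/-- The convolution of `u` with the Riesz kernel. -/
def rieszConv (α : ℝ) (u : E → ℝ) (x : E) : E :=
  ∫ z, u (x - z) • rieszKer α z

theorem integrable_indicator_ball_norm_rpow (hα : 0 < α) (S : ℝ) :
    Integrable ((Metric.ball 0 1).indicator fun z : E => S * ‖z‖ ^ (α - finrank ℝ E)) :=
  (integrable_indicator_iff measurableSet_ball).2 <| Integrable.const_mul
    ((integrableOn_ball_norm_rpow_iff volume one_pos).2 (by linarith)) S

theorem integrable_smul_rieszKer (hα : α ∈ Set.Ioo 0 1) (hu : Integrable u) (hum : Measurable u)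
    (hS : ∀ x, |u x| ≤ S) (x : E) : Integrable fun z => u (x - z) • rieszKer α z := by
  have := measurable_rieszKer (E := E) (α := α)
  refine ((integrable_indicator_ball_norm_rpow hα.1 S).add (hu.comp_sub_left x).abs).mono'
    (Measurable.aestronglyMeasurable (by fun_prop)) (Eventually.of_forall fun z => ?_)
  rw [norm_smul, norm_rieszKer hα.2]
  exact abs_mul_norm_rpow_le_rieszMajorant hα.2 (fun z => hS (x - z)) z

theorem inner_rieszConv (hα : α ∈ Set.Ioo 0 1) (hu : Integrable u) (hum : Measurable u)
    (hS : ∀ x, |u x| ≤ S) (x y : E) :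
    inner ℝ y (rieszConv α u x) =
      ∫ z, u (x - z) * inner ℝ y z * ‖z‖ ^ (α - 1 - finrank ℝ E) := by
  rw [rieszConv, ← integral_inner (integrable_smul_rieszKer hα hu hum hS x) y]
  simp only [rieszKer, inner_smul_right]
  congr! 2
  ring

theorem integrable_heatKer_mul_rieszMajorant (hα : 0 < α) (ht : 0 < t) (hu : Integrable u) (x : E) :
    Integrable fun p : E × E => ‖p.1‖ * heatKer t p.1 *
      rieszMajorant α S (fun z => u (x - p.1 - z)) p.2 := by
  have hker := integrable_norm_mul_heatKer (E := E) ht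
  have hlocal := hker.mul_prod (integrable_indicator_ball_norm_rpow (E := E) hα S)
  have hglobal := (measurePreserving_prod_add (volume : Measure E)
    volume).integrable_comp_of_integrable (hker.mul_prod (hu.comp_sub_left x).abs)
  refine (hlocal.add hglobal).congr (Eventually.of_forall fun p => ?_)
  simp only [rieszMajorant, Pi.add_apply, Function.comp_apply, mul_add, sub_sub]

theorem integrable_heatKer_mul_rieszKer (hα : α ∈ Set.Ioo 0 1) (ht : 0 < t) (hu : Integrable u)
    (hum : Measurable u) (hS : ∀ x, |u x| ≤ S) (x : E) :
    Integrable fun p : E × E => inner ℝ p.1 p.2 * heatKer t p.1 * u (x - p.1 - p.2) *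
      ‖p.2‖ ^ (α - 1 - finrank ℝ E) := by
  refine (integrable_heatKer_mul_rieszMajorant (S := S) hα.1 ht hu x).mono'
    (Measurable.aestronglyMeasurable (by fun_prop)) (Eventually.of_forall fun p => ?_)
  refine le_trans ?_ (mul_le_mul_of_nonneg_left (abs_mul_norm_rpow_le_rieszMajorant hα.2
    (fun z => hS (x - p.1 - z)) p.2) (mul_nonneg (norm_nonneg _) (heatKer_nonneg ht _)))
  rw [← norm_rieszKer hα.2, rieszKer, norm_smul, norm_mul, norm_mul, norm_mul,
    Real.norm_of_nonneg (heatKer_nonneg ht _), Real.norm_eq_abs (u _)]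
  have hker := heatKer_nonneg ht p.1
  calc ‖inner ℝ p.1 p.2‖ * heatKer t p.1 * |u (x - p.1 - p.2)| * ‖‖p.2‖ ^ (α - 1 - finrank ℝ E)‖
      ≤ ‖p.1‖ * ‖p.2‖ * heatKer t p.1 * |u (x - p.1 - p.2)| * ‖‖p.2‖ ^ (α - 1 - finrank ℝ E)‖ := by
        gcongr
        exact norm_inner_le_norm _ _
    _ = _ := by ring

theorem integral_integral_inner_mul_heatKer (ht : 0 < t) (hs : 0 < s) (hum : Measurable u)
    (hS : ∀ x, |u x| ≤ S) (x : E) :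
    ∫ z, (∫ y, inner ℝ y z * heatKer t y * u (x - y - z)) * heatKer s z =
      t * s * heatMeanDeriv u x (t + s) := by
  have hG : Integrable fun p : E × E =>
      inner ℝ p.1 p.2 * heatKer t p.1 * u (x - p.1 - p.2) * heatKer s p.2 := by
    refine (((integrable_norm_mul_heatKer ht).mul_prod (integrable_norm_mul_heatKer hs)).const_mul
      S).mono' (Measurable.aestronglyMeasurable (by fun_prop)) (Eventually.of_forall fun p => ?_)
    have ht' := heatKer_nonneg ht p.1
    have hs' := heatKer_nonneg hs p.2
    rw [norm_mul, norm_mul, norm_mul, Real.norm_of_nonneg ht', Real.norm_of_nonneg hs']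
    calc ‖inner ℝ p.1 p.2‖ * heatKer t p.1 * ‖u (x - p.1 - p.2)‖ * heatKer s p.2
        ≤ ‖p.1‖ * ‖p.2‖ * heatKer t p.1 * S * heatKer s p.2 := by
          gcongr
          exacts [norm_inner_le_norm _ _, hS _]
      _ = _ := by ring
  simp only [← integral_mul_const]
  rw [integral_integral_eq_integral_integral_sub hG, heatMeanDeriv, ← integral_const_mul]
  congr! 2
  rw [← mul_assoc, ← integral_inner_sub_mul_heatKer_mul_heatKer ht hs, ← integral_mul_const]
  congr! 2
  rw [sub_sub, add_sub_cancel]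
  ring

theorem heatMellin_mul_integral_inner_rieszConv (hα : α ∈ Set.Ioo 0 1) (hu : Integrable u)
    (hum : Measurable u) (hS : ∀ x, |u x| ≤ S) (x : E) (ht : 0 < t) :
    heatMellin E ((1 - α) / 2) * ∫ y, inner ℝ y (rieszConv α u (x - y)) * heatKer t y =
      t * ∫ s in Set.Ioi (0 : ℝ), s ^ ((1 + α) / 2 - 1) * heatMeanDeriv u x (t + s) := by
  have hexp : α - 1 - finrank ℝ E = -2 * ((1 - α) / 2) - finrank ℝ E := by ring
  have hprod := integrable_heatKer_mul_rieszKer hα ht hu hum hS x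
  have hswap : ∫ y, inner ℝ y (rieszConv α u (x - y)) * heatKer t y =
      ∫ z, (∫ y, inner ℝ y z * heatKer t y * u (x - y - z)) * ‖z‖ ^ (α - 1 - finrank ℝ E) := by
    simp only [inner_rieszConv hα hu hum hS, ← integral_mul_const]
    refine Eq.trans ?_ (integral_integral_swap (f := fun y z => inner ℝ y z * heatKer t y *
      u (x - y - z) * ‖z‖ ^ (α - 1 - finrank ℝ E)) hprod)
    congr! 4
    ring
  have hmeas : Measurable fun z => ∫ y, inner ℝ y z * heatKer t y * u (x - y - z) := by
    have hjoint : Measurable fun p : E × E =>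
      inner ℝ p.2 p.1 * heatKer t p.2 * u (x - p.2 - p.1) := by fun_prop
    exact hjoint.stronglyMeasurable.integral_prod_right'.measurable
  have hint := hprod.integral_prod_right
  simp only [integral_mul_const] at hint
  rw [hswap, hexp, heatMellin_mul_integral_mul_rpow (by linarith [hα.2]) hmeas (hexp ▸ hint),
    ← integral_const_mul]
  refine setIntegral_congr_fun measurableSet_Ioi fun s (hs : 0 < s) => ?_
  rw [integral_integral_inner_mul_heatKer ht hs hum hS,
    show (1 + α) / 2 - 1 = -((1 - α) / 2) - 1 + 1 by ring, Real.rpow_add_one hs.ne']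
  ring

variable (E) in
theorem exists_pvDiv_rieszConv (hα : α ∈ Set.Ioo 0 1) :
    ∃ c, 0 < c ∧ ∀ (u : E → ℝ) (S : ℝ) (K : ℝ≥0) (M : ℝ) (Λ : ℝ≥0), Integrable u →
      (∀ x, |u x| ≤ S) → LipschitzWith K u → IsBddLip (rieszConv α u) M Λ →
      ∀ x, pvDiv α (rieszConv α u) x = c * u x := by
  have hp : (1 + α) / 2 ∈ Set.Ioo 0 1 := ⟨by linarith [hα.1], by linarith [hα.2]⟩
  set Z := ∫ v in Set.Ioi (0 : ℝ), v ^ ((1 + α) / 2 - 1) / (1 + v)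
  have hZ : 0 < Z := setIntegral_Ioi_rpow_div_one_add_pos hp
  have h₁ : 0 < heatMellin E ((1 + α) / 2) := heatMellin_pos hp.1
  have h₂ : 0 < heatMellin E ((1 - α) / 2) := heatMellin_pos (by linarith [hα.2])
  refine ⟨Z / (heatMellin E ((1 + α) / 2) * heatMellin E ((1 - α) / 2)), by positivity,
    fun u S K M Λ hu hS hK hφ x => ?_⟩
  have hum := hK.continuous.measurable
  have hmain : heatMellin E ((1 - α) / 2) * (heatMellin E ((1 + α) / 2) *
      pvDiv α (rieszConv α u) x) = Z * u x := by
    rw [heatMellin_mul_pvDiv hα hφ, mul_neg, ← integral_const_mul, neg_eq_iff_eq_neg, ← mul_neg,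
      ← setIntegral_Ioi_heatMeanDeriv hu hK x,
      ← setIntegral_Ioi_rpow_mul_setIntegral_Ioi_rpow_mul_comp_add hp
        (measurable_heatMeanDeriv hum x) (integrableOn_heatMeanDeriv hu hK x)]
    refine setIntegral_congr_fun measurableSet_Ioi fun t (ht : 0 < t) => ?_
    rw [mul_left_comm, heatMellin_mul_integral_inner_rieszConv hα hu hum hS x ht, ← mul_assoc,
      ← Real.rpow_add_one ht.ne', sub_add_cancel]
  rw [div_mul_eq_mul_div, eq_div_iff (by positivity), ← hmain]
  ring

end Inversion

/-! ### Smooth duality for the `L¹` norm -/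

section SmoothDuality

/-- The approximation `t / √(t² + d²)` of the sign of `t`, smooth in `t` for `d ≠ 0`. -/
def smoothSign (d t : ℝ) : ℝ := t / √(t ^ 2 + d ^ 2)

theorem smoothSign_zero (d : ℝ) : smoothSign d 0 = 0 := zero_div _

theorem norm_smoothSign_le_one (d t : ℝ) : ‖smoothSign d t‖ ≤ 1 := by
  rw [smoothSign, norm_div, Real.norm_of_nonneg (Real.sqrt_nonneg _)]
  exact div_le_one_of_le₀ (Real.abs_le_sqrt (le_add_of_nonneg_right (sq_nonneg d)))
    (Real.sqrt_nonneg _)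

theorem contDiff_smoothSign {d : ℝ} (hd : d ≠ 0) : ContDiff ℝ ∞ (smoothSign d) := by
  have hpos (t : ℝ) : 0 < t ^ 2 + d ^ 2 := by positivity
  exact contDiff_id.div (((contDiff_id.pow 2).add contDiff_const).sqrt fun t => (hpos t).ne')
    fun t => (Real.sqrt_pos.2 (hpos t)).ne'

theorem tendsto_mul_smoothSign (t : ℝ) :
    Tendsto (fun d => t * smoothSign d t) (𝓝 0) (𝓝 ‖t‖) := by
  rcases eq_or_ne t 0 with rfl | ht
  · simp
  have hcont : ContinuousAt (fun d => t * smoothSign d t) 0 := by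
    have : √(t ^ 2 + 0 ^ 2) ≠ 0 := by positivity
    unfold smoothSign
    fun_prop (disch := assumption)
  have hval : t * smoothSign 0 t = ‖t‖ := by
    rw [smoothSign, zero_pow two_ne_zero, add_zero, Real.sqrt_sq_eq_abs, Real.norm_eq_abs,
      ← mul_div_assoc, div_eq_iff (abs_ne_zero.2 ht), abs_mul_abs_self]
  exact hval ▸ hcont.tendsto

variable {X : Type*} [MeasurableSpace X] {μ : Measure X} {F G g : X → ℝ}

theorem tendsto_integral_mul_smoothSign (hG : Integrable G μ) :
    Tendsto (fun d => ∫ x, G x * smoothSign d (G x) ∂μ) (𝓝 0) (𝓝 (∫ x, ‖G x‖ ∂μ)) := by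
  refine tendsto_integral_filter_of_dominated_convergence (fun x => ‖G x‖)
    (Eventually.of_forall fun d => ?_)
    (Eventually.of_forall fun d => Eventually.of_forall fun x => ?_) hG.norm
    (Eventually.of_forall fun x => tendsto_mul_smoothSign (G x))
  · have : Measurable (smoothSign d) := by unfold smoothSign; fun_prop
    exact hG.aestronglyMeasurable.mul
      (this.comp_aemeasurable hG.aestronglyMeasurable.aemeasurable).aestronglyMeasurable
  · rw [norm_mul]
    exact mul_le_of_le_one_right (norm_nonneg _) (norm_smoothSign_le_one _ _)

theorem integral_mul_le_integral_mul_add_integral_norm_sub (hF : Integrable F μ)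
    (hG : Integrable G μ) (hg : AEStronglyMeasurable g μ) (hg1 : ∀ x, ‖g x‖ ≤ 1) :
    ∫ x, G x * g x ∂μ ≤ ∫ x, F x * g x ∂μ + ∫ x, ‖F x - G x‖ ∂μ := by
  have hFg : Integrable (fun x => F x * g x) μ := hF.mul_bdd hg (Eventually.of_forall hg1)
  have hGg : Integrable (fun x => G x * g x) μ := hG.mul_bdd hg (Eventually.of_forall hg1)
  have hFG : Integrable (fun x => ‖F x - G x‖) μ := (hF.sub hG).norm
  rw [← integral_add hFg hFG]
  refine integral_mono hGg (hFg.add hFG) fun x => ?_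
  have : (G x - F x) * g x ≤ ‖F x - G x‖ := by
    rw [norm_sub_rev]
    refine (le_abs_self _).trans ?_
    rw [abs_mul]
    exact mul_le_of_le_one_right (abs_nonneg _) (hg1 x)
  simp only
  linarith

theorem integral_norm_le_of_forall_contDiff {E : Type*} [NormedAddCommGroup E] [NormedSpace ℝ E]
    [FiniteDimensional ℝ E] [MeasurableSpace E] [BorelSpace E] {μ : Measure E}
    [IsFiniteMeasureOnCompacts μ] {F : E → ℝ} {M : ℝ} (hF : Integrable F μ)
    (h : ∀ g : E → ℝ, ContDiff ℝ ∞ g → HasCompactSupport g → (∀ x, ‖g x‖ ≤ 1) →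
      ∫ x, F x * g x ∂μ ≤ M) : ∫ x, ‖F x‖ ∂μ ≤ M := by
  have := FiniteDimensional.proper ℝ E
  refine le_of_forall_pos_le_add fun ε hε => ?_
  obtain ⟨G, hGc, hGs, hFG⟩ := (memLp_one_iff_integrable.2 hF).exist_eLpNorm_sub_le
    ENNReal.one_ne_top le_rfl (half_pos hε)
  have hG : Integrable G μ := hGs.continuous.integrable_of_hasCompactSupport hGc
  have hFG : ∫ x, ‖F x - G x‖ ∂μ ≤ ε / 2 := by
    rw [eLpNorm_one_eq_lintegral_enorm,
      ← ofReal_integral_norm_eq_lintegral_enorm (hF.sub hG)] at hFG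
    exact (ENNReal.ofReal_le_ofReal_iff (half_pos hε).le).1 hFG
  have hGM : ∫ x, ‖G x‖ ∂μ ≤ M + ε / 2 := by
    have hlim : Tendsto (fun d => ∫ x, G x * smoothSign d (G x) ∂μ) (𝓝[≠] 0)
        (𝓝 (∫ x, ‖G x‖ ∂μ)) :=
      (tendsto_integral_mul_smoothSign hG).mono_left nhdsWithin_le_nhds
    refine le_of_tendsto hlim ?_
    filter_upwards [self_mem_nhdsWithin] with d hd
    have hgs : ContDiff ℝ ∞ (fun x => smoothSign d (G x)) := (contDiff_smoothSign hd).comp hGs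
    have hg1 (x : E) : ‖smoothSign d (G x)‖ ≤ 1 := norm_smoothSign_le_one d (G x)
    have hgc : HasCompactSupport fun x => smoothSign d (G x) :=
      hGc.comp_left (smoothSign_zero d)
    linarith [h _ hgs hgc hg1, integral_mul_le_integral_mul_add_integral_norm_sub hF hG
      hgs.continuous.aestronglyMeasurable hg1]
  calc ∫ x, ‖F x‖ ∂μ ≤ ∫ x, (‖F x - G x‖ + ‖G x‖) ∂μ :=
        integral_mono hF.norm ((hF.sub hG).norm.add hG.norm) fun x => by
          simpa using norm_add_le (F x - G x) (G x)
    _ = ∫ x, ‖F x - G x‖ ∂μ + ∫ x, ‖G x‖ ∂μ := integral_add (hF.sub hG).norm hG.norm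
    _ ≤ M + ε := by linarith

end SmoothDuality

/-! ### Continuity of the inclusion -/

section RieszConvTranslate

variable {E : Type*} [NormedAddCommGroup E] [InnerProductSpace ℝ E] [FiniteDimensional ℝ E]
  [Nontrivial E] [MeasurableSpace E] [BorelSpace E] {α S : ℝ} {u g : E → ℝ} {K M : ℝ≥0} {h : E}

theorem contDiff_rieszConv (hα : α ∈ Set.Ioo 0 1) (hu : ContDiff ℝ ∞ u) (hc : HasCompactSupport u) :
    ContDiff ℝ ∞ (rieszConv α u) :=
  hc.contDiff_convolution_right (μ := volume) (ContinuousLinearMap.lsmul ℝ ℝ).flip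
    (locallyIntegrable_rieszKer hα volume) hu

theorem rieszConv_translate_sub (hα : α ∈ Set.Ioo 0 1) (hg : Integrable g) (hgm : Measurable g)
    (hS : ∀ x, |g x| ≤ S) (h x : E) :
    rieszConv α (fun x => g (x - h) - g x) x =
      ∫ z, g (x - z) • (rieszKer α (z + -h) - rieszKer α z) := by
  have hint (y : E) := integrable_smul_rieszKer hα hg hgm hS y
  have hshift (z : E) : g (x - z - h) • rieszKer α z =
      (fun w => g (x - w) • rieszKer α (w + -h)) (z + h) := by
    simp only [add_neg_cancel_right, sub_sub]
  have hint₁ : Integrable fun z => g (x - z - h) • rieszKer α z := by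
    simpa only [sub_right_comm] using hint (x - h)
  have hint₂ : Integrable fun z => g (x - z) • rieszKer α (z + -h) := by
    simpa only [hshift, sub_add_cancel] using hint₁.comp_sub_right h
  have htranslate : ∫ z, g (x - z - h) • rieszKer α z = ∫ z, g (x - z) • rieszKer α (z + -h) := by
    simp only [hshift]
    exact integral_add_right_eq_self (fun w => g (x - w) • rieszKer α (w + -h)) h
  simp only [rieszConv, sub_smul, smul_sub]
  rw [integral_sub hint₁ (hint x), integral_sub hint₂ (hint x), htranslate]

theorem isBddLip_rieszConv_translate_sub (hα : α ∈ Set.Ioo 0 1) (hgi : Integrable g)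
    (hg : LipschitzWith K g) (hg1 : ∀ x, ‖g x‖ ≤ 1)
    (hM : ∫ z, ‖rieszKer α (z + -h) - rieszKer α z‖ ≤ M) :
    IsBddLip (rieszConv α fun x => g (x - h) - g x) M (K * M) := by
  have hgc := hg.continuous
  have hker : Integrable fun z => rieszKer α (z + -h) - rieszKer α z :=
    (hasPowerSingularity_rieszKer hα.2 volume).integrable_translate_sub hα (-h)
  have hconv := rieszConv_translate_sub hα hgi hgc.measurable hg1 h
  have hint (x : E) : Integrable fun z => g (x - z) • (rieszKer α (z + -h) - rieszKer α z) :=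
    hker.bdd_smul (φ := fun z => g (x - z)) 1 (Continuous.aestronglyMeasurable (by fun_prop))
      (Eventually.of_forall fun z => hg1 _)
  refine ⟨fun x => ?_, LipschitzWith.of_dist_le_mul fun x y => ?_⟩
  · rw [hconv]
    refine (norm_integral_le_of_norm_le hker.norm (Eventually.of_forall fun z => ?_)).trans hM
    rw [norm_smul]
    exact mul_le_of_le_one_left (norm_nonneg _) (hg1 _)
  · have hlip (z : E) : ‖g (x - z) - g (y - z)‖ ≤ K * ‖x - y‖ := by
      simpa only [sub_sub_sub_cancel_right] using hg.norm_sub_le (x - z) (y - z)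
    rw [dist_eq_norm, dist_eq_norm, hconv, hconv, ← integral_sub (hint x) (hint y)]
    simp only [← sub_smul]
    calc ‖∫ z, (g (x - z) - g (y - z)) • (rieszKer α (z + -h) - rieszKer α z)‖
        ≤ ∫ z, K * ‖x - y‖ * ‖rieszKer α (z + -h) - rieszKer α z‖ :=
          norm_integral_le_of_norm_le (hker.norm.const_mul _) <| Eventually.of_forall fun z => by
            rw [norm_smul]
            gcongr
            exact hlip z
      _ ≤ K * ‖x - y‖ * M := by rw [integral_const_mul]; gcongr
      _ = ↑(K * M) * ‖x - y‖ := by push_cast; ring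

end RieszConvTranslate

section SmoothCutoff

variable {E : Type*} [NormedAddCommGroup E] [InnerProductSpace ℝ E] {k : ℕ}

/-- Smooth cut-offs at scale `k + 1`: dilations of one bump function, so that they exhaust the space
and share a Lipschitz constant. -/
def smoothCutoff (k : ℕ) (x : E) : ℝ :=
  (⟨1, 2, one_pos, one_lt_two⟩ : ContDiffBump (0 : E)) ((k + 1 : ℝ)⁻¹ • x)

theorem smoothCutoff_nonneg (x : E) : 0 ≤ smoothCutoff k x := ContDiffBump.nonneg _

theorem smoothCutoff_le_one (x : E) : smoothCutoff k x ≤ 1 := ContDiffBump.le_one _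

theorem eventually_smoothCutoff_eq_one (x : E) : ∀ᶠ k in atTop, smoothCutoff k x = 1 := by
  obtain ⟨N, hN⟩ := exists_nat_ge ‖x‖
  filter_upwards [eventually_ge_atTop N] with k hk
  have hNk : (N : ℝ) ≤ k := by exact_mod_cast hk
  have hk0 : (0 : ℝ) < k + 1 := by positivity
  refine ContDiffBump.one_of_mem_closedBall _ (mem_closedBall_zero_iff.2 ?_)
  rw [norm_smul, norm_inv, Real.norm_of_nonneg hk0.le, inv_mul_le_iff₀ hk0, mul_one]
  linarith

theorem contDiff_smoothCutoff : ContDiff ℝ ∞ (smoothCutoff k : E → ℝ) :=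
  (ContDiffBump.contDiff _).comp (contDiff_const_smul _)

theorem IsBddLip.smul {χ : E → ℝ} {φ : E → E} {K Λ M : ℝ≥0} (hφ : IsBddLip φ M Λ)
    (hχ : LipschitzWith K χ) (hχ1 : ∀ x, ‖χ x‖ ≤ 1) :
    IsBddLip (fun x => χ x • φ x) M (K * M + Λ) where
  norm_le x := by
    rw [norm_smul]
    exact (mul_le_of_le_one_left (norm_nonneg _) (hχ1 x)).trans (hφ.norm_le x)
  lipschitz := LipschitzWith.of_dist_le_mul fun x y => by
    rw [dist_eq_norm, dist_eq_norm]
    calc ‖χ x • φ x - χ y • φ y‖ = ‖(χ x - χ y) • φ x + χ y • (φ x - φ y)‖ := by congr 1; module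
      _ ≤ ‖χ x - χ y‖ * ‖φ x‖ + ‖χ y‖ * ‖φ x - φ y‖ := by
        simpa only [norm_smul] using norm_add_le ((χ x - χ y) • φ x) (χ y • (φ x - φ y))
      _ ≤ K * ‖x - y‖ * M + 1 * (Λ * ‖x - y‖) := by
        gcongr
        · exact hχ.norm_sub_le x y
        · exact hφ.norm_le x
        · exact hχ1 y
        · exact hφ.lipschitz.norm_sub_le x y
      _ = ↑(K * M + Λ) * ‖x - y‖ := by push_cast; ring

variable [FiniteDimensional ℝ E]

theorem hasCompactSupport_smoothCutoff : HasCompactSupport (smoothCutoff k : E → ℝ) :=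
  (ContDiffBump.hasCompactSupport _).comp_smul (by positivity)

variable (E) in
theorem exists_lipschitzWith_smoothCutoff :
    ∃ K : ℝ≥0, ∀ k, LipschitzWith K (smoothCutoff k : E → ℝ) := by
  let b : ContDiffBump (0 : E) := ⟨1, 2, one_pos, one_lt_two⟩
  obtain ⟨K, hK⟩ :=
    (b.contDiff (n := 1)).lipschitzWith_of_hasCompactSupport b.hasCompactSupport one_ne_zero
  refine ⟨K, fun k => LipschitzWith.of_dist_le_mul fun x y => (hK.dist_le_mul _ _).trans ?_⟩
  rw [dist_smul₀, norm_inv, Real.norm_of_nonneg (by positivity : (0 : ℝ) ≤ k + 1)]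
  gcongr
  exact mul_le_of_le_one_left dist_nonneg (inv_le_one_of_one_le₀ (by simp))

end SmoothCutoff

section Duality

variable {E : Type*} [NormedAddCommGroup E] [InnerProductSpace ℝ E] [FiniteDimensional ℝ E]
  [MeasurableSpace E] [BorelSpace E] {α : ℝ} {f : E → ℝ}

theorem pvDiv_const_smul (c : ℝ) (φ : E → E) (x : E) :
    pvDiv α (fun x => c • φ x) x = c * pvDiv α φ x := by
  simp only [pvDiv, ← smul_sub, divKer_smul, integral_const_mul]

theorem integral_mul_translate_sub {g : E → ℝ} (hf : Integrable f) (hg : Continuous g)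
    (hg1 : ∀ x, ‖g x‖ ≤ 1) (h : E) :
    ∫ x, f x * (g (x - h) - g x) = ∫ x, (f (x + h) - f x) * g x := by
  have hint {F : E → ℝ} (hF : Integrable F) (y : E) : Integrable fun x => F x * g (x - y) :=
    hF.mul_bdd (g := fun x => g (x - y)) (Continuous.aestronglyMeasurable (by fun_prop))
      (Eventually.of_forall fun x => hg1 _)
  have hint₀ {F : E → ℝ} (hF : Integrable F) : Integrable fun x => F x * g x := by
    simpa only [sub_zero] using hint hF 0
  have htranslate : ∫ x, f (x + h) * g x = ∫ x, f x * g (x - h) := by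
    rw [← integral_add_right_eq_self (fun x => f x * g (x - h)) h]
    simp only [add_sub_cancel_right]
  simp only [mul_sub, sub_mul]
  rw [integral_sub (hint hf h) (hint₀ hf), integral_sub (hint₀ (hf.comp_add_right h)) (hint₀ hf),
    htranslate]

theorem tendsto_integral_mul_pvDiv [Nontrivial E] (hα : α ∈ Set.Ioo 0 1) {φ : ℕ → E → E}
    {ψ : E → E} {M : ℝ} {K : ℝ≥0} (hφ : ∀ k, IsBddLip (φ k) M K)
    (hψ : ∀ x, Tendsto (fun k => φ k x) atTop (𝓝 (ψ x))) (hf : Integrable f) :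
    Tendsto (fun k => ∫ x, f x * pvDiv α (φ k) x) atTop (𝓝 (∫ x, f x * pvDiv α ψ x)) := by
  have hpv (x : E) : Tendsto (fun k => pvDiv α (φ k) x) atTop (𝓝 (pvDiv α ψ x)) := by
    refine tendsto_integral_of_dominated_convergence (divMajorant α M K)
      (fun k => (integrable_divKer_sub hα (hφ k) x).aestronglyMeasurable)
      (integrable_divMajorant hα M K) (fun k => Eventually.of_forall (norm_divKer_sub_le (hφ k) x))
      (Eventually.of_forall fun y => ?_)
    exact (tendsto_const_nhds.inner ((hψ (x + y)).sub (hψ x))).div_const _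
  refine tendsto_integral_of_dominated_convergence
    (fun x => ‖f x‖ * ∫ y : E, divMajorant α M K y) (fun k => ?_) (hf.norm.mul_const _)
    (fun k => Eventually.of_forall fun x => ?_) (Eventually.of_forall fun x => (hpv x).const_mul _)
  · exact hf.aestronglyMeasurable.mul (continuous_pvDiv hα (hφ k)).aestronglyMeasurable
  · rw [norm_mul]
    gcongr
    exact norm_pvDiv_le hα (hφ k) x

end Duality

section Embedding

variable {n : ℕ} [NeZero n] {α : ℝ} {f : EuclideanSpace ℝ (Fin n) → ℝ}
  {φ : EuclideanSpace ℝ (Fin n) → EuclideanSpace ℝ (Fin n)} {M Λ : ℝ≥0}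

theorem muConst_mul_integral_mul_pvDiv_le_of_hasCompactSupport (hα : α ∈ Set.Ioo 0 1) (hM : 0 < M)
    (hφ : ∀ x, ‖φ x‖ ≤ M) (hs : ContDiff ℝ ∞ φ) (hc : HasCompactSupport φ)
    (hV : fracVariation α f < ⊤) :
    muConst n α * ∫ x, f x * pvDiv α φ x ≤ M * (fracVariation α f).toReal := by
  have hM0 : (0 : ℝ) < M := hM
  have hθ : IsTestField fun x => (M : ℝ)⁻¹ • φ x := by
    refine ⟨hs.const_smul _, hc.smul_left (f := fun _ => (M : ℝ)⁻¹), fun x => ?_⟩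
    rw [norm_smul, norm_inv, Real.norm_of_nonneg hM0.le, inv_mul_le_iff₀ hM0, mul_one]
    exact hφ x
  obtain ⟨K, hK⟩ := hθ.exists_isBddLip
  have hle : ∫ x, f x * fracDiv α (fun x => (M : ℝ)⁻¹ • φ x) x ≤ (fracVariation α f).toReal :=
    (ENNReal.ofReal_le_iff_le_toReal hV.ne).1 (le_iSup₂_of_le _ hθ le_rfl)
  simp only [fracDiv_eq hα hK, pvDiv_const_smul, mul_left_comm (f _), integral_const_mul] at hle
  rwa [mul_left_comm, inv_mul_le_iff₀ hM0] at hle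

theorem muConst_mul_integral_mul_pvDiv_le (hα : α ∈ Set.Ioo 0 1) (hM : 0 < M)
    (hφ : IsBddLip φ M Λ) (hs : ContDiff ℝ ∞ φ) (hf : Integrable f)
    (hV : fracVariation α f < ⊤) :
    muConst n α * ∫ x, f x * pvDiv α φ x ≤ M * (fracVariation α f).toReal := by
  obtain ⟨K, hK⟩ := exists_lipschitzWith_smoothCutoff (EuclideanSpace ℝ (Fin n))
  have hcut (k : ℕ) : IsBddLip (fun x => smoothCutoff k x • φ x) M (K * M + Λ) :=
    hφ.smul (hK k) fun x => by
      rw [Real.norm_of_nonneg (smoothCutoff_nonneg x)]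
      exact smoothCutoff_le_one x
  have hlim := tendsto_integral_mul_pvDiv hα hcut (ψ := φ) (fun x => by
    refine tendsto_const_nhds.congr' ?_
    filter_upwards [eventually_smoothCutoff_eq_one x] with k hk
    rw [hk, one_smul]) hf
  exact le_of_tendsto (hlim.const_mul _) (Eventually.of_forall fun k =>
    muConst_mul_integral_mul_pvDiv_le_of_hasCompactSupport hα hM (hcut k).norm_le
      (contDiff_smoothCutoff.smul hs) hasCompactSupport_smoothCutoff.smul_right hV)

variable (n) in
theorem exists_integral_norm_translate_sub_le_fracVariation (hα : α ∈ Set.Ioo 0 1) :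
    ∃ C, 0 < C ∧ ∀ f : EuclideanSpace ℝ (Fin n) → ℝ, Integrable f → fracVariation α f < ⊤ →
      ∀ h, ∫ x, ‖f (x + h) - f x‖ ≤ C * (fracVariation α f).toReal * ‖h‖ ^ α := by
  obtain ⟨D, hD, hker⟩ := (hasPowerSingularity_rieszKer (E := EuclideanSpace ℝ (Fin n)) hα.2
    volume).exists_integral_norm_translate_sub_le hα
  obtain ⟨c, hc, hinv⟩ := exists_pvDiv_rieszConv (EuclideanSpace ℝ (Fin n)) hα
  have hμ : 0 < muConst n α := muConst_pos hα
  refine ⟨D / (muConst n α * c), by positivity, fun f hf hV h => ?_⟩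
  rcases eq_or_ne h 0 with rfl | hh
  · simp only [add_zero, sub_self, norm_zero, integral_zero]; positivity
  refine integral_norm_le_of_forall_contDiff ((hf.comp_add_right h).sub hf) fun g hgs hgc hg1 => ?_
  obtain ⟨K, hK⟩ := hgs.lipschitzWith_of_hasCompactSupport hgc (by simp)
  have hgi : Integrable g := hgs.continuous.integrable_of_hasCompactSupport hgc
  set u := fun x => g (x - h) - g x
  have hus : ContDiff ℝ ∞ u := (hgs.comp (contDiff_id.sub contDiff_const)).sub hgs
  have huc : HasCompactSupport u := (hgc.comp_homeomorph (Homeomorph.subRight h)).sub hgc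
  obtain ⟨M, hMD⟩ : ∃ M : ℝ≥0, (M : ℝ) = D * ‖h‖ ^ α := ⟨⟨D * ‖h‖ ^ α, by positivity⟩, rfl⟩
  have hM : 0 < M := by
    have := norm_pos_iff.2 hh
    exact NNReal.coe_pos.1 (hMD ▸ by positivity)
  have hbl : IsBddLip (rieszConv α u) M (K * M) :=
    isBddLip_rieszConv_translate_sub hα hgi hK hg1 (by simpa only [hMD, norm_neg] using hker (-h))
  have hpv : ∀ x, pvDiv α (rieszConv α u) x = c * u x := by
    obtain ⟨S, hS⟩ := huc.exists_bound_of_continuous hus.continuous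
    obtain ⟨L, hL⟩ := hus.lipschitzWith_of_hasCompactSupport huc (by simp)
    exact hinv u S L M (K * M) (hus.continuous.integrable_of_hasCompactSupport huc) hS hL hbl
  have hle := muConst_mul_integral_mul_pvDiv_le hα hM hbl (contDiff_rieszConv hα hus huc) hf hV
  simp only [hpv, mul_left_comm (f _), integral_const_mul] at hle
  rw [integral_mul_translate_sub hf hgs.continuous hg1, ← mul_assoc, hMD] at hle
  rw [show D / (muConst n α * c) * (fracVariation α f).toReal * ‖h‖ ^ α =
    D * ‖h‖ ^ α * (fracVariation α f).toReal / (muConst n α * c) by ring,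
    le_div_iff₀' (by positivity)]
  exact hle

variable (n) in
theorem exists_besovSeminorm_le (hα : α ∈ Set.Ioo 0 1) :
    ∃ C : ℝ≥0, ∀ f ∈ BVSpace n α, besovSeminorm α f ≤ C * fracVariation α f := by
  obtain ⟨C, hC, hle⟩ := exists_integral_norm_translate_sub_le_fracVariation n hα
  refine ⟨C.toNNReal, fun f hf => ?_⟩
  have hfi := memLp_one_iff_integrable.1 hf.1
  refine (besovSeminorm_le_ofReal hfi (hle f hfi hf.2)).trans_eq ?_
  rw [ENNReal.ofReal_mul hC.le, ENNReal.ofReal_toReal hf.2.ne]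
  rfl

theorem BVSpace_subset_BesovSpace (hα : α ∈ Set.Ioo 0 1) : BVSpace n α ⊆ BesovSpace n α := by
  obtain ⟨C, hC⟩ := exists_besovSeminorm_le n hα
  exact fun f hf => ⟨hf.1, (hC f hf).trans_lt (ENNReal.mul_lt_top ENNReal.coe_lt_top hf.2)⟩

variable (n) in
theorem exists_besovNorm_le (hα : α ∈ Set.Ioo 0 1) :
    ∃ C : ℝ≥0, ∀ f ∈ BVSpace n α, besovNorm α f ≤ C * bvNorm α f := by
  obtain ⟨C, hC⟩ := exists_besovSeminorm_le n hα
  refine ⟨1 + C, fun f hf => ?_⟩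
  calc eLpNorm f 1 volume + besovSeminorm α f
      ≤ 1 * eLpNorm f 1 volume + C * fracVariation α f := by
        rw [one_mul]
        gcongr
        exact hC f hf
    _ ≤ (1 + C) * eLpNorm f 1 volume + (1 + C) * fracVariation α f := by
        gcongr
        · exact le_self_add
        · exact le_add_self
    _ = ↑(1 + C) * bvNorm α f := by rw [bvNorm, mul_add]; push_cast; rfl

theorem BVSpace_ssubset_BesovSpace (hα : α ∈ Set.Ioo 0 1) : BVSpace n α ⊂ BesovSpace n α :=
  (Set.ssubset_iff_of_subset (BVSpace_subset_BesovSpace hα)).2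
    ⟨_, witness_mem_BesovSpace hα isRadialCutoff_piecewiseLinear,
      witness_notMem_BVSpace hα isRadialCutoff_piecewiseLinear⟩

end Embedding

end FracBV

theorem mainTheorem9_general (n : ℕ) [NeZero n] (α : ℝ) (hα : α ∈ Set.Ioo (0 : ℝ) 1) :
    (∃ C : ℝ≥0, ∀ f ∈ FracBV.BVSpace n α, FracBV.besovNorm α f ≤ C * FracBV.bvNorm α f) ∧
    FracBV.BVSpace n α ⊂ FracBV.BesovSpace n α ∧
    ∀ (η : ℝ → ℝ) (L : ℝ≥0), FracBV.IsRadialCutoff η L →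
      FracBV.witness n α η ∈ FracBV.BesovSpace n α ∧
      ¬ MemLp (FracBV.witness n α η) (ENNReal.ofReal ((n : ℝ) / ((n : ℝ) - α))) volume ∧
      FracBV.witness n α η ∉ FracBV.BVSpace n α := by
  have hαn : α < n := hα.2.trans_le (by exact_mod_cast NeZero.one_le)
  refine ⟨FracBV.exists_besovNorm_le n hα, FracBV.BVSpace_ssubset_BesovSpace hα,
    fun η L hη => ⟨?_, ?_, ?_⟩⟩
  · exact FracBV.witness_mem_BesovSpace hα hη
  · exact FracBV.not_memLp_witness hαn hη
  · exact FracBV.witness_notMem_BVSpace hα hη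

theorem mainTheorem9 (n : ℕ) (hn : 2 ≤ n) (α : ℝ) (hα : α ∈ Set.Ioo (0 : ℝ) 1) :
    (∃ C : ℝ≥0, ∀ f ∈ FracBV.BVSpace n α, FracBV.besovNorm α f ≤ C * FracBV.bvNorm α f) ∧
    FracBV.BVSpace n α ⊂ FracBV.BesovSpace n α ∧
    ∀ η : ℝ → ℝ, FracBV.IsCutoffProfile η →
      FracBV.witness n α η ∈ FracBV.BesovSpace n α ∧
      ¬ MemLp (FracBV.witness n α η) (ENNReal.ofReal ((n : ℝ) / ((n : ℝ) - α))) volume ∧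
      FracBV.witness n α η ∉ FracBV.BVSpace n α := by
  have : NeZero n := ⟨by lia⟩
  obtain ⟨hle, hssub, hwitness⟩ := mainTheorem9_general n α hα
  exact ⟨hle, hssub, fun η hη => hwitness η 3 hη.isRadialCutoff⟩

end
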